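/- Let $d\ge 1$, let $\Omega=\hat K=[0,1]^d$ be the unit cube, let $\hat S$ be a finite-dimensional subspace of the real space $L^2(\hat K)$, and let $r\ge 0$ be an integer. For $n=1,2,\dots$ and $h=1/n$, let $\mathcal T_h$ be the uniform mesh of $\Omega$ into $n^d$ subcubes $K=x_K+h\hat K$, and let $S_h$ be the space of all functions $v:\Omega\to\mathbb R$ such that, for every $K\in\mathcal T_h$, the function $\hat x\mapsto v(x_K+h\hat x)$ on $\hat K$ agrees almost everywhere with an element of $\hat S$ (no continuity between elements is imposed). Let $\mathcal P_r$ denote the real polynomials in $d$ variables of total degree at most $r$, and for $u$ in the Sobolev space $H^{r+1}(\Omega)$ let $|u|_{r+1}=\bigl(\sum_{|\alpha|=r+1}\|D^\alpha u\|_{L^2(\Omega)}^2\bigr)^{1/2}$. The following conditions are equivalent: 1. There is a constant $C$ such that $\displaystyle\inf_{v\in S_h}\|u-v\|_{L^2(\Omega)}\le C h^{r+1}|u|_{r+1}$ for all $u\in H^{r+1}(\Omega)$ and all $h=1/n$, $n=1,2,\dots$. 2. For all $u\in\mathcal P_r(\Omega)$, $\displaystyle\inf_{v\in S_h}\|u-v\|_{L^2(\Omega)}=o(h^r)$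 as $h=1/n\to0$. 3. $\mathcal P_r(\hat K)\subset\hat S$. -/

import Mathlib

open MeasureTheory Filter Asymptotics
open scoped ENNReal Distributions

noncomputable section

namespace CubeApprox

/-- The closed unit cube `[0,1]^d`; it plays the role both of the reference element and of the
domain. -/
def unitCube (d : ℕ) : Set (Fin d → ℝ) := Set.Icc 0 1

/-- Lebesgue measure on the unit cube. -/
def cubeMeasure (d : ℕ) : Measure (Fin d → ℝ) := volume.restrict (unitCube d)

/-- The interior of the unit cube, as an open set. -/
def openUnitCube (d : ℕ) : TopologicalSpace.Opens (Fin d → ℝ) :=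
  ⟨interior (unitCube d), isOpen_interior⟩

/-- The real Hilbert space `L²` of the unit cube. -/
abbrev L2Cube (d : ℕ) : Type := Lp ℝ 2 (cubeMeasure d)

/-! ### Sobolev spaces on the cube -/

/-- The classical partial derivative `∂f/∂x_i`. -/
def partialDeriv {d : ℕ} (i : Fin d) (f : (Fin d → ℝ) → ℝ) : (Fin d → ℝ) → ℝ :=
  fun x => fderiv ℝ f x (Pi.single i 1)

/-- The classical partial derivative `D^α f = ∂_0^{α_0} ⋯ ∂_{d-1}^{α_{d-1}} f` for a
multi-index `α`. -/
def multiDeriv {d : ℕ} (α : Fin d → ℕ) (f : (Fin d → ℝ) → ℝ) : (Fin d → ℝ) → ℝ :=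
  (List.finRange d).foldr (fun i g => (partialDeriv i)^[α i] g) f

/-- `g` is a weak derivative `D^α u` on the open unit cube: for every test function `φ`,
`∫ u D^α φ = (-1)^{|α|} ∫ g φ`. It is used below for square-integrable `u` and `g` only. -/
def IsWeakDeriv {d : ℕ} (α : Fin d → ℕ) (u g : (Fin d → ℝ) → ℝ) : Prop :=
  ∀ φ : 𝓓(openUnitCube d, ℝ),
    ∫ x, u x * multiDeriv α φ x ∂(cubeMeasure d) =
      (-1 : ℝ) ^ (∑ i, α i) * ∫ x, g x * φ x ∂(cubeMeasure d)

/-- `u ∈ H^k` of the unit cube: `u` and all its weak derivatives of order at most `k` are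
square-integrable. -/
def MemSobolev {d : ℕ} (k : ℕ) (u : (Fin d → ℝ) → ℝ) : Prop :=
  MemLp u 2 (cubeMeasure d) ∧
    ∀ α : Fin d → ℕ, ∑ i, α i ≤ k →
      ∃ g : (Fin d → ℝ) → ℝ, MemLp g 2 (cubeMeasure d) ∧ IsWeakDeriv α u g

open Classical in
/-- The square-integrable weak derivative `D^α u` (unique up to null sets) where there is one,
and `0` otherwise. -/
def weakDeriv {d : ℕ} (α : Fin d → ℕ) (u : (Fin d → ℝ) → ℝ) : (Fin d → ℝ) → ℝ :=
  if h : ∃ g : (Fin d → ℝ) → ℝ, MemLp g 2 (cubeMeasure d) ∧ IsWeakDeriv α u g then h.choose else 0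

/-- The Sobolev seminorm `|u|_k = (∑_{|α| = k} ‖D^α u‖²)^{1/2}` on the unit cube. -/
def sobolevSeminorm {d : ℕ} (k : ℕ) (u : (Fin d → ℝ) → ℝ) : ℝ :=
  √(∑ α ∈ Finset.piAntidiag (Finset.univ : Finset (Fin d)) k,
    (eLpNorm (weakDeriv α u) 2 (cubeMeasure d)).toReal ^ 2)

/-! ### Piecewise spaces on uniform cube meshes -/

/-- The function `f`, restricted to the unit cube, agrees almost everywhere with an element
of `S`. -/
def BelongsTo {d : ℕ} (S : Submodule ℝ (L2Cube d)) (f : (Fin d → ℝ) → ℝ) : Prop :=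
  ∃ w ∈ S, f =ᵐ[cubeMeasure d] w

/-- The map `x ↦ x_K + h x` with `h = 1/n` and `x_K = h i`, from the unit cube onto the cell with
index `i ∈ {0, …, n-1}^d` of the uniform mesh of the unit cube into `n^d` subcubes. -/
def cellMap {d : ℕ} (n : ℕ) (i : Fin d → Fin n) (x : Fin d → ℝ) : Fin d → ℝ :=
  fun j => ((i j : ℕ) : ℝ) / n + (1 / n : ℝ) * x j

/-- The space `S_h`, `h = 1/n`: the functions whose restriction to each cell of the uniform mesh,
pulled back to the unit cube, belongs to `S`. No continuity between cells is imposed. -/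
def meshSpace {d : ℕ} (S : Submodule ℝ (L2Cube d)) (n : ℕ) : Set ((Fin d → ℝ) → ℝ) :=
  {v | ∀ i : Fin d → Fin n, BelongsTo S (fun x => v (cellMap n i x))}

/-- The error `inf_{v ∈ S_h} ‖u - v‖` of the best `L²` approximation on the unit cube by elements
of `S_h`, `h = 1/n`. The infimum is finite for `u ∈ L²`, see `iInf_meshSpace_lt_top`. -/
def bestError {d : ℕ} (S : Submodule ℝ (L2Cube d)) (n : ℕ) (u : (Fin d → ℝ) → ℝ) : ℝ :=
  (⨅ v ∈ meshSpace S n, eLpNorm (u - v) 2 (cubeMeasure d)).toReal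

theorem zero_mem_meshSpace {d : ℕ} (S : Submodule ℝ (L2Cube d)) (n : ℕ) :
    (0 : (Fin d → ℝ) → ℝ) ∈ meshSpace S n :=
  fun _ => ⟨0, S.zero_mem, (Lp.coeFn_zero ℝ 2 (cubeMeasure d)).symm⟩

theorem iInf_meshSpace_lt_top {d : ℕ} (S : Submodule ℝ (L2Cube d)) (n : ℕ)
    {u : (Fin d → ℝ) → ℝ} (hu : MemLp u 2 (cubeMeasure d)) :
    ⨅ v ∈ meshSpace S n, eLpNorm (u - v) 2 (cubeMeasure d) < ⊤ :=
  lt_of_le_of_lt (iInf₂_le 0 (zero_mem_meshSpace S n)) (by simpa using hu.eLpNorm_lt_top)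

end CubeApprox

end

/-!
On the cell `x_K + h K̂` with `h = 1/n`, a polynomial `p` of degree at most `k` satisfies
`p (x_K + h x) = h ^ k p x + q x` with `q` of degree less than `k` (`affineSubst_sub_mem`). If `S`
contains all such `q`, the `n ^ d` cells therefore contribute equally to the error, which is at least
`h ^ k` times the distance of `p` from `S` (`le_bestError`). An error `o(h ^ r)` forces this distance
to vanish, and `S` is closed; so by induction on the degree `S` contains all polynomials of degree at
most `r` (`belongsTo_of_isLittleO`). The first condition implies the second because the seminorm of
order `r + 1` annihilates polynomials of degree at most `r` (`sobolevSeminorm_eval`).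

Conversely, if `S` contains the polynomials of degree at most `r`, the error estimate follows from the
Bramble–Hilbert lemma on the unit cube (`brambleHilbert`) by scaling to the cells and adding up the
squared errors (`mesh_error_le`).

The Bramble–Hilbert lemma follows from the Poincaré inequality (`poincare`) by induction on the order:
subtracting a polynomial of degree `k`, one may shift each derivative of order `k` by a constant of
one's choice. The Poincaré inequality `‖v - m‖ ≤ C ∑ i, ‖∂_i v‖` is proved by duality, without
approximating `v` by smooth functions. For a test function `φ`, replacing `φ` by its average in one
coordinate (times a fixed bump function) changes it by `∂_i T_i φ`, where `T_i φ` is again a test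
function with `‖T_i φ‖ ≤ 2 ‖φ‖` (`partialDeriv_coordCorrector`, `l2norm_coordCorrector_le`); hence the
pairing with `v` changes by at most `2 ‖∂_i v‖ ‖φ‖`. After all coordinates have been averaged, only
the integral of `φ` is left (`exists_average`), so that `v` minus a suitable constant pairs with `φ`
to at most `C ‖φ‖ ∑ i, ‖∂_i v‖`, and test functions are dense in `L²`
(`l2norm_le_of_forall_isTest`).
-/

open scoped ContDiff

namespace CubeApprox

variable {d : ℕ}

/-! ### Partial derivatives of smooth functions -/

theorem contDiff_partialDeriv {f : (Fin d → ℝ) → ℝ} (hf : ContDiff ℝ ∞ f) (i : Fin d) :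
    ContDiff ℝ ∞ (partialDeriv i f) :=
  (hf.fderiv_right (m := ∞) (by simp)).clm_apply contDiff_const

theorem contDiff_iterate_partialDeriv {f : (Fin d → ℝ) → ℝ} (hf : ContDiff ℝ ∞ f) (i : Fin d)
    (k : ℕ) : ContDiff ℝ ∞ ((partialDeriv i)^[k] f) := by
  induction k with
  | zero => exact hf
  | succ k ih => rw [Function.iterate_succ_apply']; exact contDiff_partialDeriv ih i

theorem partialDeriv_comm {f : (Fin d → ℝ) → ℝ} (hf : ContDiff ℝ ∞ f) (i j : Fin d) :
    partialDeriv i (partialDeriv j f) = partialDeriv j (partialDeriv i f) := by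
  -- Both sides are values of the second Fréchet derivative, which is symmetric.
  have h1 : ∀ k l : Fin d, ∀ x, partialDeriv k (partialDeriv l f) x =
      fderiv ℝ (fderiv ℝ f) x (Pi.single k 1) (Pi.single l 1) := by
    intro k l x
    have hd : DifferentiableAt ℝ (fderiv ℝ f) x :=
      (hf.fderiv_right (m := ∞) (by simp)).differentiable (by simp) x
    unfold partialDeriv
    rw [fderiv_clm_apply hd (differentiableAt_const _)]
    simp
  ext x
  rw [h1, h1]
  have hs : IsSymmSndFDerivAt ℝ f x := hf.contDiffAt.isSymmSndFDerivAt (by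
    rw [minSmoothness_of_isRCLikeNormedField]
    exact WithTop.coe_le_coe.2 (le_top : (2 : ℕ∞) ≤ ⊤))
  exact hs _ _

theorem partialDeriv_iterate_comm {f : (Fin d → ℝ) → ℝ} (hf : ContDiff ℝ ∞ f) (i j : Fin d)
    (k : ℕ) : partialDeriv i ((partialDeriv j)^[k] f) = (partialDeriv j)^[k] (partialDeriv i f) := by
  induction k with
  | zero => rfl
  | succ k ih =>
    rw [Function.iterate_succ_apply', Function.iterate_succ_apply',
      partialDeriv_comm (contDiff_iterate_partialDeriv hf j k), ih]

/-- The iterated partial derivative along the coordinates in a list; `multiDeriv` is the case of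
the list of all coordinates. -/
noncomputable def listDeriv (l : List (Fin d)) (α : Fin d → ℕ) (f : (Fin d → ℝ) → ℝ) :
    (Fin d → ℝ) → ℝ :=
  l.foldr (fun i g => (partialDeriv i)^[α i] g) f

theorem listDeriv_cons (j : Fin d) (l : List (Fin d)) (α : Fin d → ℕ) (f : (Fin d → ℝ) → ℝ) :
    listDeriv (j :: l) α f = (partialDeriv j)^[α j] (listDeriv l α f) := rfl

theorem contDiff_listDeriv {f : (Fin d → ℝ) → ℝ} (hf : ContDiff ℝ ∞ f) (l : List (Fin d))
    (α : Fin d → ℕ) : ContDiff ℝ ∞ (listDeriv l α f) := by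
  induction l with
  | nil => exact hf
  | cons j l ih => exact contDiff_iterate_partialDeriv ih j _

theorem partialDeriv_listDeriv {f : (Fin d → ℝ) → ℝ} (hf : ContDiff ℝ ∞ f) (l : List (Fin d))
    (α : Fin d → ℕ) (i : Fin d) :
    partialDeriv i (listDeriv l α f) = listDeriv l α (partialDeriv i f) := by
  induction l with
  | nil => rfl
  | cons j l ih =>
    rw [listDeriv_cons, listDeriv_cons, partialDeriv_iterate_comm (contDiff_listDeriv hf l α), ih]

theorem listDeriv_add_single_of_notMem (f : (Fin d → ℝ) → ℝ) {l : List (Fin d)} {i : Fin d}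
    (α : Fin d → ℕ) (hi : i ∉ l) : listDeriv l (α + Pi.single i 1) f = listDeriv l α f := by
  induction l with
  | nil => rfl
  | cons j l ih =>
    rw [List.mem_cons, not_or] at hi
    rw [listDeriv_cons, listDeriv_cons, ih hi.2]
    simp [Pi.single_eq_of_ne (Ne.symm hi.1)]

theorem listDeriv_add_single_of_mem {f : (Fin d → ℝ) → ℝ} (hf : ContDiff ℝ ∞ f)
    {l : List (Fin d)} (hl : l.Nodup) {i : Fin d} (α : Fin d → ℕ) (hi : i ∈ l) :
    listDeriv l (α + Pi.single i 1) f = listDeriv l α (partialDeriv i f) := by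
  induction l with
  | nil => simp at hi
  | cons j l ih =>
    rw [List.nodup_cons] at hl
    rw [listDeriv_cons, listDeriv_cons]
    by_cases hij : i = j
    · subst hij
      rw [listDeriv_add_single_of_notMem f α hl.1, ← partialDeriv_listDeriv hf]
      simp [Function.iterate_succ_apply]
    · rw [ih hl.2 ((List.mem_cons.1 hi).resolve_left hij)]
      simp [Pi.single_eq_of_ne (Ne.symm hij)]

theorem multiDeriv_zero (f : (Fin d → ℝ) → ℝ) : multiDeriv 0 f = f := by
  suffices h : ∀ l : List (Fin d), listDeriv l 0 f = f from h _
  intro l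
  induction l with
  | nil => rfl
  | cons j l ih => rw [listDeriv_cons, ih]; rfl

theorem multiDeriv_add_single {f : (Fin d → ℝ) → ℝ} (hf : ContDiff ℝ ∞ f) (α : Fin d → ℕ)
    (i : Fin d) : multiDeriv (α + Pi.single i 1) f = multiDeriv α (partialDeriv i f) :=
  listDeriv_add_single_of_mem hf (List.nodup_finRange d) α (List.mem_finRange i)

theorem multiDeriv_single {f : (Fin d → ℝ) → ℝ} (hf : ContDiff ℝ ∞ f) (i : Fin d) :
    multiDeriv (Pi.single i 1) f = partialDeriv i f := by
  have := multiDeriv_add_single hf 0 i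
  rwa [zero_add, multiDeriv_zero] at this

theorem sum_add_single (α : Fin d → ℕ) (i : Fin d) :
    ∑ j, (α + Pi.single i 1 : Fin d → ℕ) j = ∑ j, α j + 1 := by
  simp [Finset.sum_add_distrib]

/-- Induction on a multi-index, one derivative at a time. -/
theorem multiIndex_induction {p : (Fin d → ℕ) → Prop} (zero : p 0)
    (step : ∀ α i, p α → p (α + Pi.single i 1)) (α : Fin d → ℕ) : p α := by
  induction h : ∑ i, α i generalizing α with
  | zero =>
    have : α = 0 := by
      ext i
      exact (Finset.sum_eq_zero_iff.1 h) i (Finset.mem_univ i)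
    exact this ▸ zero
  | succ k ih =>
    obtain ⟨i, -, hi⟩ : ∃ i ∈ Finset.univ, α i ≠ 0 := by
      by_contra! hc
      simp [Finset.sum_eq_zero hc] at h
    have e : α = (α - Pi.single i 1) + Pi.single i 1 := by
      ext j
      by_cases hj : j = i
      · subst hj; simp; omega
      · simp [Pi.single_eq_of_ne hj]
    rw [e]
    refine step _ _ (ih _ ?_)
    rw [e, sum_add_single] at h
    omega

/-! ### Test functions -/

/-- A smooth function on `ℝ^d` supported in a box `[δ, 1 - δ]^d` with `δ > 0`; these are exactly
the test functions of the open unit cube, see `isTest_coe` and `IsTest.toTestFunction`. -/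
def IsTest (φ : (Fin d → ℝ) → ℝ) : Prop :=
  ContDiff ℝ ∞ φ ∧ ∃ δ > 0, ∀ x, φ x ≠ 0 → ∀ j, δ ≤ x j ∧ x j ≤ 1 - δ

theorem unitCube_eq_pi : unitCube d = Set.univ.pi fun _ => Set.Icc (0 : ℝ) 1 := by
  rw [unitCube, ← Set.pi_univ_Icc]; rfl

theorem mem_openUnitCube_iff {x : Fin d → ℝ} :
    x ∈ interior (unitCube d) ↔ ∀ j, 0 < x j ∧ x j < 1 := by
  rw [unitCube_eq_pi, interior_pi_set Set.finite_univ]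
  simp [interior_Icc]

theorem tsupport_subset_of_box {φ : (Fin d → ℝ) → ℝ} {δ : ℝ}
    (h : ∀ x, φ x ≠ 0 → ∀ j, δ ≤ x j ∧ x j ≤ 1 - δ) :
    tsupport φ ⊆ Set.Icc (fun _ => δ) (fun _ => 1 - δ) :=
  closure_minimal (fun x hx => ⟨fun j => (h x hx j).1, fun j => (h x hx j).2⟩) isClosed_Icc

theorem IsTest.hasCompactSupport {φ : (Fin d → ℝ) → ℝ} (h : IsTest φ) : HasCompactSupport φ := by
  obtain ⟨δ, -, hδ⟩ := h.2
  exact isCompact_Icc.of_isClosed_subset (isClosed_tsupport φ) (tsupport_subset_of_box hδ)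

theorem IsTest.tsupport_subset {φ : (Fin d → ℝ) → ℝ} (h : IsTest φ) :
    tsupport φ ⊆ interior (unitCube d) := by
  obtain ⟨δ, hδ0, hδ⟩ := h.2
  intro x hx
  have hx := tsupport_subset_of_box hδ hx
  rw [mem_openUnitCube_iff]
  intro j
  have h1 : δ ≤ x j := hx.1 j
  have h2 : x j ≤ 1 - δ := hx.2 j
  constructor <;> linarith

/-- A smooth function supported in a box inside the open cube, as a bundled test function. -/
def IsTest.toTestFunction {φ : (Fin d → ℝ) → ℝ} (h : IsTest φ) : 𝓓(openUnitCube d, ℝ) :=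
  ⟨φ, h.1, h.hasCompactSupport, h.tsupport_subset⟩

theorem isTest_of_tsupport_subset {φ : (Fin d → ℝ) → ℝ} (h : ContDiff ℝ ∞ φ)
    (hc : HasCompactSupport φ) (hs : tsupport φ ⊆ interior (unitCube d)) : IsTest φ := by
  refine ⟨h, ?_⟩
  obtain ⟨δ, hδ, hsub⟩ := hc.isCompact.exists_cthickening_subset_open isOpen_interior hs
  refine ⟨δ, hδ, fun x hx j => ?_⟩
  -- Points at distance at most `δ` from the support, in the sup norm, lie in the open cube.
  have key : ∀ s : ℝ, |s| ≤ δ → 0 < x j + s ∧ x j + s < 1 := by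
    intro s hs'
    have hmem : Function.update x j (x j + s) ∈ Metric.cthickening δ (tsupport φ) := by
      refine Metric.mem_cthickening_of_dist_le _ x _ _ (subset_tsupport φ hx) ?_
      rw [dist_pi_le_iff hδ.le]
      intro k
      by_cases hk : k = j
      · subst hk; simpa [Real.dist_eq] using hs'
      · simp [Function.update_of_ne hk, hδ.le]
    simpa using mem_openUnitCube_iff.1 (hsub hmem) j
  have h1 := (key (-δ) (by simp [abs_of_pos hδ])).1
  have h2 := (key δ (by simp [abs_of_pos hδ])).2
  constructor <;> linarith

theorem isTest_coe (φ : 𝓓(openUnitCube d, ℝ)) : IsTest (φ : (Fin d → ℝ) → ℝ) :=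
  isTest_of_tsupport_subset φ.contDiff φ.hasCompactSupport φ.tsupport_subset

theorem isWeakDeriv_iff {α : Fin d → ℕ} {u g : (Fin d → ℝ) → ℝ} :
    IsWeakDeriv α u g ↔ ∀ φ : (Fin d → ℝ) → ℝ, IsTest φ →
      ∫ x, u x * multiDeriv α φ x ∂(cubeMeasure d) =
        (-1 : ℝ) ^ (∑ i, α i) * ∫ x, g x * φ x ∂(cubeMeasure d) :=
  ⟨fun h _ hφ => h hφ.toTestFunction, fun h φ => h φ (isTest_coe φ)⟩

theorem IsTest.partialDeriv {φ : (Fin d → ℝ) → ℝ} (h : IsTest φ) (i : Fin d) :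
    IsTest (partialDeriv i φ) := by
  obtain ⟨δ, hδ0, hδ⟩ := h.2
  refine ⟨contDiff_partialDeriv h.1 i, δ, hδ0, fun x hx j => ?_⟩
  have hx : x ∈ tsupport φ := by
    by_contra hc
    apply hx
    have : fderiv ℝ φ x = 0 := by
      by_contra h0
      exact hc (support_fderiv_subset ℝ h0)
    simp [CubeApprox.partialDeriv, this]
  have := tsupport_subset_of_box hδ hx
  exact ⟨this.1 j, this.2 j⟩

theorem IsTest.multiDeriv {φ : (Fin d → ℝ) → ℝ} (h : IsTest φ) (α : Fin d → ℕ) :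
    IsTest (multiDeriv α φ) := by
  induction α using multiIndex_induction generalizing φ with
  | zero => rwa [multiDeriv_zero]
  | step α i ih => rw [multiDeriv_add_single h.1]; exact ih (h.partialDeriv i)

theorem IsTest.add {φ ψ : (Fin d → ℝ) → ℝ} (h : IsTest φ) (h' : IsTest ψ) :
    IsTest (fun x => φ x + ψ x) := by
  obtain ⟨δ, hδ0, hδ⟩ := h.2
  obtain ⟨ε, hε0, hε⟩ := h'.2
  refine ⟨h.1.add h'.1, min δ ε, lt_min hδ0 hε0, fun x hx j => ?_⟩
  by_cases h0 : φ x = 0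
  · have := hε x (by simpa [h0] using hx) j
    exact ⟨(min_le_right _ _).trans this.1, this.2.trans (by linarith [min_le_right δ ε])⟩
  · have := hδ x h0 j
    exact ⟨(min_le_left _ _).trans this.1, this.2.trans (by linarith [min_le_left δ ε])⟩

theorem IsTest.const_mul {φ : (Fin d → ℝ) → ℝ} (h : IsTest φ) (c : ℝ) :
    IsTest (fun x => c * φ x) := by
  obtain ⟨δ, hδ0, hδ⟩ := h.2
  exact ⟨contDiff_const.mul h.1, δ, hδ0, fun x hx => hδ x (right_ne_zero_of_mul hx)⟩

theorem IsTest.sub {φ ψ : (Fin d → ℝ) → ℝ} (h : IsTest φ) (h' : IsTest ψ) :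
    IsTest (fun x => φ x - ψ x) := by
  have := h.add (h'.const_mul (-1))
  simpa [sub_eq_add_neg] using this

instance : IsProbabilityMeasure (cubeMeasure d) := by
  constructor
  rw [cubeMeasure, Measure.restrict_apply_univ, unitCube, Real.volume_Icc_pi]
  simp

theorem IsTest.memLp {φ : (Fin d → ℝ) → ℝ} (h : IsTest φ) (p : ℝ≥0∞) :
    MemLp φ p (cubeMeasure d) :=
  h.1.continuous.memLp_of_hasCompactSupport h.hasCompactSupport

theorem memLp_of_continuous {f : (Fin d → ℝ) → ℝ} (hf : Continuous f) :
    MemLp f 2 (cubeMeasure d) := by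
  obtain ⟨C, hC⟩ := (isCompact_Icc (a := (0 : Fin d → ℝ)) (b := 1)).exists_bound_of_continuousOn
    hf.continuousOn
  refine MemLp.of_bound hf.aestronglyMeasurable C ?_
  exact (ae_restrict_iff' measurableSet_Icc).2 (ae_of_all _ hC)

theorem integrable_mul {f g : (Fin d → ℝ) → ℝ} (hf : MemLp f 2 (cubeMeasure d))
    (hg : MemLp g 2 (cubeMeasure d)) : Integrable (fun x => f x * g x) (cubeMeasure d) :=
  hf.integrable_mul hg

/-- An integral over the cube against a function supported in the cube is an integral over the
whole space. -/
theorem integral_cube_eq {f : (Fin d → ℝ) → ℝ} (h : ∀ x ∉ unitCube d, f x = 0) :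
    ∫ x, f x ∂(cubeMeasure d) = ∫ x, f x := by
  rw [cubeMeasure]
  exact setIntegral_eq_integral_of_forall_compl_eq_zero h

theorem IsTest.eq_zero {φ : (Fin d → ℝ) → ℝ} (h : IsTest φ) {x : Fin d → ℝ} (hx : x ∉ unitCube d) :
    φ x = 0 := by
  by_contra h0
  exact hx (interior_subset (h.tsupport_subset (subset_tsupport φ h0)))

/-! ### The `L²` norm and duality with test functions -/

/-- The `L²` norm on the unit cube, as a real number. -/
noncomputable def l2norm (f : (Fin d → ℝ) → ℝ) : ℝ := (eLpNorm f 2 (cubeMeasure d)).toReal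

theorem l2norm_nonneg (f : (Fin d → ℝ) → ℝ) : 0 ≤ l2norm f := ENNReal.toReal_nonneg

theorem l2norm_eq_norm_toLp {f : (Fin d → ℝ) → ℝ} (hf : MemLp f 2 (cubeMeasure d)) :
    l2norm f = ‖hf.toLp f‖ := (Lp.norm_toLp f hf).symm

theorem l2norm_congr {f g : (Fin d → ℝ) → ℝ} (h : f =ᵐ[cubeMeasure d] g) : l2norm f = l2norm g := by
  rw [l2norm, l2norm, eLpNorm_congr_ae h]

theorem l2norm_const_mul (c : ℝ) (f : (Fin d → ℝ) → ℝ) :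
    l2norm (fun x => c * f x) = |c| * l2norm f := by
  have : (fun x => c * f x) = c • f := rfl
  rw [l2norm, l2norm, this, eLpNorm_const_smul]
  simp

theorem inner_toLp {f g : (Fin d → ℝ) → ℝ} (hf : MemLp f 2 (cubeMeasure d))
    (hg : MemLp g 2 (cubeMeasure d)) :
    inner ℝ (hf.toLp f) (hg.toLp g) = ∫ x, f x * g x ∂(cubeMeasure d) := by
  rw [L2.inner_def]
  refine integral_congr_ae ?_
  filter_upwards [hf.coeFn_toLp, hg.coeFn_toLp] with x h1 h2
  rw [h1, h2]
  simp [mul_comm]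

theorem abs_integral_mul_le {f g : (Fin d → ℝ) → ℝ} (hf : MemLp f 2 (cubeMeasure d))
    (hg : MemLp g 2 (cubeMeasure d)) :
    |∫ x, f x * g x ∂(cubeMeasure d)| ≤ l2norm f * l2norm g := by
  rw [← inner_toLp hf hg, l2norm_eq_norm_toLp hf, l2norm_eq_norm_toLp hg]
  exact abs_real_inner_le_norm _ _

theorem cubeMeasure_eq_restrict_interior :
    cubeMeasure d = volume.restrict (interior (unitCube d)) := by
  have h2 : interior (unitCube d) = Set.univ.pi fun _ => Set.Ioo (0 : ℝ) 1 := by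
    rw [unitCube_eq_pi, interior_pi_set Set.finite_univ]
    simp [interior_Icc]
  rw [cubeMeasure]
  refine Measure.restrict_congr_set ?_
  rw [h2, unitCube_eq_pi]
  exact Measure.pi_Ioo_ae_eq_pi_Icc.symm

/-- The fundamental lemma of the calculus of variations on the cube. -/
theorem ae_eq_zero_of_integral_isTest {w : (Fin d → ℝ) → ℝ} (hw : MemLp w 2 (cubeMeasure d))
    (h : ∀ φ, IsTest φ → ∫ x, w x * φ x ∂(cubeMeasure d) = 0) : w =ᵐ[cubeMeasure d] 0 := by
  have hint : IntegrableOn w (interior (unitCube d)) := by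
    have : Integrable w (cubeMeasure d) := hw.integrable (by norm_num)
    rwa [cubeMeasure_eq_restrict_interior] at this
  have key := isOpen_interior.ae_eq_zero_of_integral_contDiff_smul_eq_zero
    (U := interior (unitCube d)) (f := w) (μ := volume) hint.locallyIntegrableOn (fun g hg hc hs => by
      have ht := isTest_of_tsupport_subset hg hc hs
      rw [← h g ht, integral_cube_eq (fun x hx => by rw [ht.eq_zero hx, mul_zero])]
      simp [mul_comm])
  rw [cubeMeasure_eq_restrict_interior]
  exact (ae_restrict_iff' isOpen_interior.measurableSet).2 key

/-- An `L²` bound may be verified against test functions, as these are dense in `L²`. -/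
theorem l2norm_le_of_forall_isTest {w : (Fin d → ℝ) → ℝ} (hw : MemLp w 2 (cubeMeasure d)) {B : ℝ}
    (hB : 0 ≤ B) (h : ∀ φ, IsTest φ → |∫ x, w x * φ x ∂(cubeMeasure d)| ≤ B * l2norm φ) :
    l2norm w ≤ B := by
  let T : Submodule ℝ (L2Cube d) :=
    { carrier := {f | ∃ φ, ∃ hφ : IsTest φ, f = (hφ.memLp 2).toLp φ}
      add_mem' := by
        rintro _ _ ⟨φ, hφ, rfl⟩ ⟨ψ, hψ, rfl⟩
        exact ⟨_, hφ.add hψ, rfl⟩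
      zero_mem' := ⟨fun _ => 0, ⟨contDiff_const, 1, one_pos, fun x hx => absurd rfl hx⟩, rfl⟩
      smul_mem' := by
        rintro c _ ⟨φ, hφ, rfl⟩
        exact ⟨_, hφ.const_mul c, rfl⟩ }
  have hT : T.topologicalClosure = ⊤ := by
    rw [Submodule.topologicalClosure_eq_top_iff, Submodule.eq_bot_iff]
    intro f hf
    rw [Submodule.mem_orthogonal] at hf
    have hz := ae_eq_zero_of_integral_isTest (Lp.memLp f) (fun φ hφ => by
      have := hf _ ⟨φ, hφ, rfl⟩
      rw [← inner_toLp (Lp.memLp f) (hφ.memLp 2), Lp.toLp_coeFn, real_inner_comm]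
      exact this)
    exact Lp.eq_zero_iff_ae_eq_zero.2 hz
  have hcl : IsClosed {f : L2Cube d | |inner ℝ (hw.toLp w) f| ≤ B * ‖f‖} :=
    isClosed_le (by fun_prop) (by fun_prop)
  have hmem : hw.toLp w ∈ T.topologicalClosure := hT ▸ Submodule.mem_top
  have hle : |inner ℝ (hw.toLp w) (hw.toLp w)| ≤ B * ‖hw.toLp w‖ := by
    refine closure_minimal (s := (T : Set (L2Cube d))) ?_ hcl hmem
    rintro _ ⟨φ, hφ, rfl⟩
    rw [Set.mem_ofPred_eq, inner_toLp, ← l2norm_eq_norm_toLp]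
    exact h φ hφ
  rw [real_inner_self_eq_norm_sq, abs_of_nonneg (sq_nonneg _)] at hle
  rw [l2norm_eq_norm_toLp hw]
  rcases (norm_nonneg (hw.toLp w)).eq_or_lt with h0 | h0
  · rw [← h0]; exact hB
  · nlinarith

/-! ### Calculus of weak derivatives -/

theorem IsWeakDeriv.ae_eq {α : Fin d → ℕ} {u g g' : (Fin d → ℝ) → ℝ}
    (hg : MemLp g 2 (cubeMeasure d)) (hg' : MemLp g' 2 (cubeMeasure d))
    (h : IsWeakDeriv α u g) (h' : IsWeakDeriv α u g') : g =ᵐ[cubeMeasure d] g' := by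
  rw [isWeakDeriv_iff] at h h'
  have hz := ae_eq_zero_of_integral_isTest (hg.sub hg') (fun φ hφ => by
    have e := (h φ hφ).symm.trans (h' φ hφ)
    have e : ∫ x, g x * φ x ∂(cubeMeasure d) = ∫ x, g' x * φ x ∂(cubeMeasure d) :=
      mul_left_cancel₀ (pow_ne_zero _ (by norm_num)) e
    simp only [Pi.sub_apply, sub_mul]
    rw [integral_sub (integrable_mul hg (hφ.memLp 2)) (integrable_mul hg' (hφ.memLp 2)), e, sub_self])
  filter_upwards [hz] with x hx
  simpa [sub_eq_zero] using hx

theorem isWeakDeriv_zero (u : (Fin d → ℝ) → ℝ) : IsWeakDeriv 0 u u := by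
  intro φ
  simp [multiDeriv_zero]

theorem isWeakDeriv_single_iff {i : Fin d} {u g : (Fin d → ℝ) → ℝ} :
    IsWeakDeriv (Pi.single i 1) u g ↔ ∀ φ, IsTest φ →
      ∫ x, u x * partialDeriv i φ x ∂(cubeMeasure d) =
        - ∫ x, g x * φ x ∂(cubeMeasure d) := by
  rw [isWeakDeriv_iff]
  refine forall₂_congr fun φ hφ => ?_
  rw [multiDeriv_single hφ.1]
  simp

/-- If `g = D^α u` and `g' = ∂_i D^α u` weakly, then `g' = D^{α + e_i} u` weakly, and conversely. -/
theorem IsWeakDeriv.single_iff {α : Fin d → ℕ} {i : Fin d} {u g g' : (Fin d → ℝ) → ℝ}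
    (h : IsWeakDeriv α u g) :
    IsWeakDeriv (Pi.single i 1) g g' ↔ IsWeakDeriv (α + Pi.single i 1) u g' := by
  rw [isWeakDeriv_single_iff, isWeakDeriv_iff]
  rw [isWeakDeriv_iff] at h
  refine forall₂_congr fun φ hφ => ?_
  rw [multiDeriv_add_single hφ.1, h _ (hφ.partialDeriv i), sum_add_single, pow_succ, mul_assoc]
  constructor
  · intro e; rw [e]; ring
  · intro e
    have := mul_left_cancel₀ (pow_ne_zero _ (by norm_num)) e
    rw [this]; ring

theorem isWeakDeriv_partialDeriv {f : (Fin d → ℝ) → ℝ} (hf : ContDiff ℝ ∞ f) (i : Fin d) :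
    IsWeakDeriv (Pi.single i 1) f (partialDeriv i f) := by
  rw [isWeakDeriv_single_iff]
  intro φ hφ
  have hφ' := hφ.partialDeriv i
  have hint : ∀ {a b : (Fin d → ℝ) → ℝ}, ContDiff ℝ ∞ a → IsTest b →
      Integrable (fun x => a x * b x) := fun ha hb =>
    (ha.continuous.mul hb.1.continuous).integrable_of_hasCompactSupport hb.hasCompactSupport.mul_left
  rw [integral_cube_eq (fun x hx => by rw [hφ'.eq_zero hx, mul_zero]),
    integral_cube_eq (fun x hx => by rw [hφ.eq_zero hx, mul_zero])]
  exact integral_mul_fderiv_eq_neg_fderiv_mul_of_integrable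
    (hint (contDiff_partialDeriv hf i) hφ) (hint hf hφ') (hint hf hφ)
    (fun x _ => hf.differentiable (by simp) x) (fun x _ => hφ.1.differentiable (by simp) x)

theorem IsWeakDeriv.add {α : Fin d → ℕ} {u v g h : (Fin d → ℝ) → ℝ}
    (hu : MemLp u 2 (cubeMeasure d)) (hv : MemLp v 2 (cubeMeasure d))
    (hg : MemLp g 2 (cubeMeasure d)) (hh : MemLp h 2 (cubeMeasure d))
    (hug : IsWeakDeriv α u g) (hvh : IsWeakDeriv α v h) :
    IsWeakDeriv α (fun x => u x + v x) (fun x => g x + h x) := by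
  rw [isWeakDeriv_iff] at *
  intro φ hφ
  have hm := hφ.multiDeriv α
  simp only [add_mul]
  rw [integral_add (integrable_mul hu (hm.memLp 2)) (integrable_mul hv (hm.memLp 2)),
    integral_add (integrable_mul hg (hφ.memLp 2)) (integrable_mul hh (hφ.memLp 2)),
    hug φ hφ, hvh φ hφ]
  ring

theorem IsWeakDeriv.const_mul {α : Fin d → ℕ} {u g : (Fin d → ℝ) → ℝ}
    (hug : IsWeakDeriv α u g) (c : ℝ) :
    IsWeakDeriv α (fun x => c * u x) (fun x => c * g x) := by
  intro φ
  simp only [mul_assoc]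
  rw [integral_const_mul, integral_const_mul, hug φ]
  ring

theorem IsWeakDeriv.sub {α : Fin d → ℕ} {u v g h : (Fin d → ℝ) → ℝ}
    (hu : MemLp u 2 (cubeMeasure d)) (hv : MemLp v 2 (cubeMeasure d))
    (hg : MemLp g 2 (cubeMeasure d)) (hh : MemLp h 2 (cubeMeasure d))
    (hug : IsWeakDeriv α u g) (hvh : IsWeakDeriv α v h) :
    IsWeakDeriv α (fun x => u x - v x) (fun x => g x - h x) := by
  have := hug.add hu (hv.const_mul (-1)) hg (hh.const_mul (-1)) (hvh.const_mul (-1))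
  simpa [sub_eq_add_neg] using this

/-! ### Weak derivatives of polynomials -/

theorem contDiff_eval (p : MvPolynomial (Fin d) ℝ) :
    ContDiff ℝ ∞ (fun x => MvPolynomial.eval x p) := by
  induction p using MvPolynomial.induction_on with
  | C a => simpa using contDiff_const
  | add p q hp hq => simpa using hp.add hq
  | mul_X p i hp => simpa using hp.mul (contDiff_apply ℝ ℝ i)

theorem memLp_eval (p : MvPolynomial (Fin d) ℝ) :
    MemLp (fun x => MvPolynomial.eval x p) 2 (cubeMeasure d) :=
  memLp_of_continuous (contDiff_eval p).continuous

theorem partialDeriv_eval (p : MvPolynomial (Fin d) ℝ) (i : Fin d) :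
    partialDeriv i (fun x => MvPolynomial.eval x p) =
      fun x => MvPolynomial.eval x (MvPolynomial.pderiv i p) := by
  have hdiff : ∀ (q : MvPolynomial (Fin d) ℝ) x,
      DifferentiableAt ℝ (fun x => MvPolynomial.eval x q) x :=
    fun q x => (contDiff_eval q).differentiable (by simp) x
  ext x
  induction p using MvPolynomial.induction_on with
  | C a => simp [partialDeriv]
  | add p q hp hq =>
    simp only [partialDeriv, map_add] at *
    rw [fderiv_fun_add (hdiff p x) (hdiff q x), ← hp, ← hq]
    rfl
  | mul_X p j hp =>
    simp only [partialDeriv, map_mul, MvPolynomial.eval_X] at *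
    rw [fderiv_fun_mul (hdiff p x) (differentiableAt_apply j x)]
    have : fderiv ℝ (fun y : Fin d → ℝ => y j) x = ContinuousLinearMap.proj j :=
      (ContinuousLinearMap.proj (R := ℝ) (φ := fun _ : Fin d => ℝ) j).fderiv
    rw [this]
    simp [hp, MvPolynomial.pderiv_X, Pi.single_apply, eq_comm]
    split_ifs <;> simp

/-- `D^α x^s = (∏ i, s_i (s_i - 1) ⋯ (s_i - α_i + 1)) x^{s - α}`; where `α_i > s_i` for some `i` the
coefficient vanishes, so that the truncated subtraction does no harm. -/
theorem isWeakDeriv_monomial (α : Fin d → ℕ) (s : Fin d →₀ ℕ) (a : ℝ) :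
    IsWeakDeriv α (fun x => MvPolynomial.eval x (MvPolynomial.monomial s a))
      (fun x => MvPolynomial.eval x (MvPolynomial.monomial (s - Finsupp.equivFunOnFinite.symm α)
        (a * ∏ i, ((s i).descFactorial (α i) : ℝ)))) := by
  induction α using multiIndex_induction with
  | zero =>
    have : Finsupp.equivFunOnFinite.symm (0 : Fin d → ℕ) = 0 := by ext; simp
    simpa [this] using isWeakDeriv_zero _
  | step α i ih =>
    rw [← ih.single_iff]
    have hexp : s - Finsupp.equivFunOnFinite.symm (α + Pi.single i 1) =
        s - Finsupp.equivFunOnFinite.symm α - Finsupp.single i 1 := by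
      ext j
      by_cases hj : j = i
      · subst hj; simp; omega
      · simp [Pi.single_eq_of_ne hj, Finsupp.single_eq_of_ne hj]
    have hcoef : a * ∏ j, ((s j).descFactorial ((α + Pi.single i 1 : Fin d → ℕ) j) : ℝ) =
        a * (∏ j, ((s j).descFactorial (α j) : ℝ)) *
          ((s - Finsupp.equivFunOnFinite.symm α) i : ℕ) := by
      rw [mul_assoc]
      congr 1
      rw [← Finset.mul_prod_erase _ _ (Finset.mem_univ i),
        ← Finset.mul_prod_erase _ _ (Finset.mem_univ i)]
      have : ∀ j ∈ Finset.univ.erase i, ((s j).descFactorial ((α + Pi.single i 1 : Fin d → ℕ) j) : ℝ)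
          = (s j).descFactorial (α j) := by
        intro j hj
        simp [Pi.single_eq_of_ne (Finset.ne_of_mem_erase hj)]
      rw [Finset.prod_congr rfl this]
      simp [Nat.descFactorial_succ]
      ring
    have := isWeakDeriv_partialDeriv (contDiff_eval (MvPolynomial.monomial
      (s - Finsupp.equivFunOnFinite.symm α) (a * ∏ i, ((s i).descFactorial (α i) : ℝ)))) i
    rwa [partialDeriv_eval, MvPolynomial.pderiv_monomial, ← hexp, ← hcoef] at this

/-! ### Averaging and integrating in one coordinate -/

theorem cubeMeasure_eq_pi :
    cubeMeasure d = Measure.pi fun _ : Fin d => (volume : Measure ℝ).restrict (Set.Icc 0 1) := by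
  rw [cubeMeasure, unitCube_eq_pi, volume_pi, Measure.restrict_pi_pi]

instance : IsProbabilityMeasure ((volume : Measure ℝ).restrict (Set.Icc 0 1)) :=
  ⟨by simp⟩

theorem eLpNorm_two_sq {X : Type*} [MeasurableSpace X] (f : X → ℝ) (μ : Measure X) :
    eLpNorm f 2 μ ^ 2 = ∫⁻ x, ‖f x‖ₑ ^ 2 ∂μ := by
  have := eLpNorm_nnreal_pow_eq_lintegral (f := f) (μ := μ) (p := 2) (by norm_num)
  simpa using this

theorem lintegral_slice (i : Fin d) {f : (Fin d → ℝ) → ℝ≥0∞} (hf : Measurable f) :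
    ∫⁻ x, (∫⁻ t in Set.Icc (0 : ℝ) 1, f (Function.update x i t)) ∂(cubeMeasure d) =
      ∫⁻ x, f x ∂(cubeMeasure d) := by
  rw [cubeMeasure_eq_pi]
  have hm : Measurable fun x : Fin d → ℝ => ∫⁻ t in Set.Icc (0 : ℝ) 1, f (Function.update x i t) :=
    Measurable.lintegral_prod_right (hf.comp (by fun_prop :
      Measurable fun z : (Fin d → ℝ) × ℝ => Function.update z.1 i z.2))
  refine lintegral_eq_of_lmarginal_eq {i} hm hf ?_
  rw [lmarginal_singleton, lmarginal_singleton]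
  ext x
  simp

/-- A function dominated on the cube by the `L²` norms of the slices of `φ` in one coordinate is
dominated in `L²` by `φ`. -/
theorem l2norm_le_of_slice {φ F : (Fin d → ℝ) → ℝ} (hφ : IsTest φ) (i : Fin d) {c : ℝ}
    (hc : 0 ≤ c) (h : ∀ x ∈ unitCube d, ‖F x‖ₑ ≤ ENNReal.ofReal c *
      eLpNorm (fun t => φ (Function.update x i t)) 2 (volume.restrict (Set.Icc 0 1))) :
    l2norm F ≤ c * l2norm φ := by
  have hsq : eLpNorm F 2 (cubeMeasure d) ^ 2 ≤
      (ENNReal.ofReal c * eLpNorm φ 2 (cubeMeasure d)) ^ 2 := by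
    rw [mul_pow, eLpNorm_two_sq, eLpNorm_two_sq,
      ← lintegral_slice i (hφ.1.continuous.measurable.enorm.pow_const 2),
      ← lintegral_const_mul' _ _ (by finiteness)]
    refine lintegral_mono_ae ?_
    refine (ae_restrict_iff' measurableSet_Icc).2 (ae_of_all _ fun x hx => ?_)
    refine (pow_le_pow_left' (h x hx) 2).trans ?_
    rw [mul_pow, eLpNorm_two_sq]
  have hle := (ENNReal.pow_le_pow_left_iff two_ne_zero).1 hsq
  have := ENNReal.toReal_mono (by have := (hφ.memLp 2).eLpNorm_ne_top; finiteness) hle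
  rwa [ENNReal.toReal_mul, ENNReal.toReal_ofReal hc] at this

/-- A smooth monotone transition from `0` on `(-∞, 1/4]` to `1` on `[3/4, ∞)`. -/
noncomputable def cutoff (s : ℝ) : ℝ := Real.smoothTransition (2 * s - 1 / 2)

theorem contDiff_cutoff : ContDiff ℝ ∞ cutoff :=
  Real.smoothTransition.contDiff.comp (by fun_prop)

theorem cutoff_of_le {s : ℝ} (h : s ≤ 1 / 4) : cutoff s = 0 :=
  Real.smoothTransition.zero_of_nonpos (by linarith)

theorem cutoff_of_ge {s : ℝ} (h : 3 / 4 ≤ s) : cutoff s = 1 :=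
  Real.smoothTransition.one_of_one_le (by linarith)

theorem abs_cutoff_le (s : ℝ) : |cutoff s| ≤ 1 :=
  abs_le.2 ⟨by linarith [Real.smoothTransition.nonneg (2 * s - 1 / 2), cutoff.eq_1 s],
    Real.smoothTransition.le_one _⟩

theorem exists_abs_deriv_cutoff_le : ∃ M : ℝ, 0 ≤ M ∧ ∀ s ∈ Set.Icc (0 : ℝ) 1, |deriv cutoff s| ≤ M := by
  have hc : Continuous (deriv cutoff) := contDiff_cutoff.continuous_deriv (by simp)
  obtain ⟨M, hM⟩ := (isCompact_Icc (a := (0 : ℝ)) (b := 1)).exists_bound_of_continuousOn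
    hc.continuousOn
  exact ⟨M, (abs_nonneg _).trans (hM 0 (by simp)), hM⟩

/-- The primitive of `φ` in the coordinate `i` vanishing at `-∞`. -/
noncomputable def coordPrimitive (i : Fin d) (φ : (Fin d → ℝ) → ℝ) (x : Fin d → ℝ) : ℝ :=
  ∫ t in Set.Iic (x i), φ (Function.update x i t)

/-- The integral of `φ` over the coordinate `i`, spread out again by the bump function `deriv cutoff`.
The integral is the primitive at `1`, as `φ` is supported in the cube. -/
noncomputable def coordAverage (i : Fin d) (φ : (Fin d → ℝ) → ℝ) (x : Fin d → ℝ) : ℝ :=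
  deriv cutoff (x i) * coordPrimitive i φ (Function.update x i 1)

/-- The primitive of `φ - coordAverage i φ` in the coordinate `i`. It has compact support, because
`φ` and `coordAverage i φ` have the same integral over this coordinate. -/
noncomputable def coordCorrector (i : Fin d) (φ : (Fin d → ℝ) → ℝ) (x : Fin d → ℝ) : ℝ :=
  coordPrimitive i φ x - cutoff (x i) * coordPrimitive i φ (Function.update x i 1)

theorem coordPrimitive_update (i : Fin d) (φ : (Fin d → ℝ) → ℝ) (x : Fin d → ℝ) (s : ℝ) :
    coordPrimitive i φ (Function.update x i s) = ∫ t in Set.Iic s, φ (Function.update x i t) := by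
  simp [coordPrimitive]

theorem contDiff_update_const (i : Fin d) (a : ℝ) :
    ContDiff ℝ ∞ (fun x : Fin d → ℝ => Function.update x i a) := by
  rw [contDiff_pi]
  intro j
  by_cases hj : j = i
  · subst hj; simpa using contDiff_const
  · simpa [Function.update_of_ne hj] using contDiff_apply ℝ ℝ j

theorem contDiff_update_uncurried (i : Fin d) :
    ContDiff ℝ ∞ (fun z : (Fin d → ℝ) × ℝ => Function.update z.1 i z.2) := by
  rw [contDiff_pi]
  intro j
  by_cases hj : j = i
  · subst hj; simpa using contDiff_snd
  · simp only [Function.update_of_ne hj]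
    exact (contDiff_apply ℝ ℝ j).comp contDiff_fst

theorem IsTest.update_eq_zero {φ : (Fin d → ℝ) → ℝ} (h : IsTest φ) (i : Fin d) (x : Fin d → ℝ)
    {t : ℝ} (ht : t ∉ Set.Icc (0 : ℝ) 1) : φ (Function.update x i t) = 0 := by
  refine h.eq_zero fun hx => ht ⟨?_, ?_⟩
  · simpa using hx.1 i
  · simpa using hx.2 i

theorem IsTest.continuous_update {φ : (Fin d → ℝ) → ℝ} (h : IsTest φ) (i : Fin d) (x : Fin d → ℝ) :
    Continuous fun t => φ (Function.update x i t) :=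
  h.1.continuous.comp (by fun_prop)

theorem IsTest.integrable_update {φ : (Fin d → ℝ) → ℝ} (h : IsTest φ) (i : Fin d) (x : Fin d → ℝ) :
    Integrable fun t => φ (Function.update x i t) :=
  (h.continuous_update i x).integrable_of_hasCompactSupport
    (HasCompactSupport.intro isCompact_Icc fun _ ht => h.update_eq_zero i x ht)

/-- The primitive is the convolution, in the coordinate `i`, with the Heaviside function. -/
theorem contDiff_coordPrimitive {φ : (Fin d → ℝ) → ℝ} (h : IsTest φ) (i : Fin d) :
    ContDiff ℝ ∞ (coordPrimitive i φ) := by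
  have key := contDiffOn_convolution_right_with_param_comp (𝕜 := ℝ) (μ := (volume : Measure ℝ))
    (n := ⊤) (ContinuousLinearMap.mul ℝ ℝ) (s := (Set.univ : Set (Fin d → ℝ)))
    (v := fun x => x i) (contDiff_apply ℝ ℝ i).contDiffOn
    (f := Set.indicator (Set.Ici (0 : ℝ)) 1) (g := fun x t => φ (Function.update x i t))
    (k := Set.Icc 0 1) isOpen_univ isCompact_Icc (fun x t _ ht => h.update_eq_zero i x ht)
    ((locallyIntegrable_const (1 : ℝ)).indicator measurableSet_Ici)
    ((h.1.comp (contDiff_update_uncurried i)).contDiffOn)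
  rw [contDiffOn_univ] at key
  convert key using 1
  ext x
  rw [convolution_def, coordPrimitive, ← integral_indicator measurableSet_Iic,
    ← integral_sub_left_eq_self _ _ (x i)]
  refine integral_congr_ae (ae_of_all _ fun t => ?_)
  by_cases ht : 0 ≤ t
  · simp [Set.indicator, ht]
  · simp [Set.indicator, ht]

theorem partialDeriv_eq_of_hasDerivAt {f : (Fin d → ℝ) → ℝ} {x : Fin d → ℝ} {i : Fin d} {f' : ℝ}
    (hf : DifferentiableAt ℝ f x)
    (h : HasDerivAt (fun s => f (Function.update x i s)) f' (x i)) : partialDeriv i f x = f' := by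
  have hu : HasDerivAt (Function.update x i) (Pi.single i 1) (x i) := hasDerivAt_update x i (x i)
  have hf' : HasFDerivAt f (fderiv ℝ f x) (Function.update x i (x i)) := by
    rw [Function.update_eq_self]; exact hf.hasFDerivAt
  exact (hf'.comp_hasDerivAt _ hu).unique h

theorem contDiff_coordCorrector {φ : (Fin d → ℝ) → ℝ} (h : IsTest φ) (i : Fin d) :
    ContDiff ℝ ∞ (coordCorrector i φ) :=
  (contDiff_coordPrimitive h i).sub ((contDiff_cutoff.comp (contDiff_apply ℝ ℝ i)).mul
    ((contDiff_coordPrimitive h i).comp (contDiff_update_const i 1)))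

theorem partialDeriv_coordCorrector {φ : (Fin d → ℝ) → ℝ} (h : IsTest φ) (i : Fin d) :
    partialDeriv i (coordCorrector i φ) = fun x => φ x - coordAverage i φ x := by
  ext x
  refine partialDeriv_eq_of_hasDerivAt ((contDiff_coordCorrector h i).differentiable (by simp) x) ?_
  simp only [coordCorrector, Function.update_idem, Function.update_self]
  have h1 : HasDerivAt (fun s => coordPrimitive i φ (Function.update x i s)) (φ x) (x i) := by
    have e : (fun s => coordPrimitive i φ (Function.update x i s)) = fun s =>
        (∫ t in (0 : ℝ)..s, φ (Function.update x i t)) +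
          ∫ t in Set.Iic (0 : ℝ), φ (Function.update x i t) := by
      ext s
      rw [coordPrimitive_update, ← intervalIntegral.integral_Iic_sub_Iic
        (h.integrable_update i x).integrableOn (h.integrable_update i x).integrableOn]
      ring
    rw [e]
    have := (h.continuous_update i x).integral_hasStrictDerivAt 0 (x i)
    simpa using this.hasDerivAt.add_const (∫ t in Set.Iic (0 : ℝ), φ (Function.update x i t))
  have h2 : HasDerivAt cutoff (deriv cutoff (x i)) (x i) :=
    (contDiff_cutoff.differentiable (by simp) _).hasDerivAt
  exact h1.sub (h2.mul_const _)

theorem isTest_coordCorrector {φ : (Fin d → ℝ) → ℝ} (h : IsTest φ) (i : Fin d) :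
    IsTest (coordCorrector i φ) := by
  obtain ⟨δ, hδ0, hδ⟩ := h.2
  refine ⟨contDiff_coordCorrector h i, min δ (1 / 4), lt_min hδ0 (by norm_num), fun x hx j => ?_⟩
  have hle1 := min_le_left δ (1 / 4)
  have hle2 := min_le_right δ (1 / 4)
  by_contra hc
  apply hx
  by_cases hj : j = i
  · subst hj
    -- Below the support and the transition both terms vanish; above, they are equal.
    by_cases hlow : x j < min δ (1 / 4)
    · have h1 : coordPrimitive j φ x = 0 := by
        rw [coordPrimitive]
        refine setIntegral_eq_zero_of_forall_eq_zero fun t ht => ?_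
        by_contra h0
        have := (hδ _ h0 j).1
        simp only [Function.update_self] at this
        have ht : t ≤ x j := ht
        linarith
      rw [coordCorrector, h1, cutoff_of_le (by linarith)]
      ring
    · have hhigh : 1 - min δ (1 / 4) < x j := by
        by_contra hh
        exact hc ⟨not_lt.1 hlow, not_lt.1 hh⟩
      have htop : ∀ s : ℝ, 1 - δ < s →
          coordPrimitive j φ (Function.update x j s) = ∫ t, φ (Function.update x j t) := by
        intro s hs
        rw [coordPrimitive_update]
        refine setIntegral_eq_integral_of_forall_compl_eq_zero fun t ht => ?_
        by_contra h0
        have := (hδ _ h0 j).2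
        simp only [Function.update_self] at this
        have ht : ¬ t ≤ s := ht
        linarith
      have h1 := htop (x j) (by linarith)
      rw [Function.update_eq_self] at h1
      rw [coordCorrector, h1, htop 1 (by linarith), cutoff_of_ge (by linarith)]
      ring
  · have hz : ∀ t, φ (Function.update x i t) = 0 := by
      intro t
      by_contra h0
      have := hδ _ h0 j
      rw [Function.update_of_ne hj] at this
      exact hc ⟨by linarith, by linarith⟩
    simp [coordCorrector, coordPrimitive, hz]

theorem isTest_coordAverage {φ : (Fin d → ℝ) → ℝ} (h : IsTest φ) (i : Fin d) :
    IsTest (coordAverage i φ) := by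
  have := h.sub ((isTest_coordCorrector h i).partialDeriv i)
  rw [partialDeriv_coordCorrector h i] at this
  simpa using this

theorem enorm_coordPrimitive_le {φ : (Fin d → ℝ) → ℝ} (h : IsTest φ) (i : Fin d) (x : Fin d → ℝ)
    (s : ℝ) : ‖coordPrimitive i φ (Function.update x i s)‖ₑ ≤
      eLpNorm (fun t => φ (Function.update x i t)) 2 (volume.restrict (Set.Icc 0 1)) := by
  rw [coordPrimitive_update]
  calc ‖∫ t in Set.Iic s, φ (Function.update x i t)‖ₑ
      ≤ ∫⁻ t in Set.Iic s, ‖φ (Function.update x i t)‖ₑ := enorm_integral_le_lintegral_enorm _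
    _ ≤ ∫⁻ t, ‖φ (Function.update x i t)‖ₑ := setLIntegral_le_lintegral _ _
    _ = ∫⁻ t in Set.Icc 0 1, ‖φ (Function.update x i t)‖ₑ := by
        refine (setLIntegral_eq_of_support_subset fun t ht => ?_).symm
        by_contra h0
        exact ht (by simp [h.update_eq_zero i x h0])
    _ = eLpNorm (fun t => φ (Function.update x i t)) 1 (volume.restrict (Set.Icc 0 1)) :=
        eLpNorm_one_eq_lintegral_enorm.symm
    _ ≤ _ := eLpNorm_le_eLpNorm_of_exponent_le (by norm_num)
        (h.continuous_update i x).aestronglyMeasurable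

theorem l2norm_coordCorrector_le {φ : (Fin d → ℝ) → ℝ} (h : IsTest φ) (i : Fin d) :
    l2norm (coordCorrector i φ) ≤ 2 * l2norm φ := by
  refine l2norm_le_of_slice h i (by norm_num) fun x _ => ?_
  have h1 := enorm_coordPrimitive_le h i x (x i)
  rw [Function.update_eq_self] at h1
  have h2 := enorm_coordPrimitive_le h i x 1
  have h3 : ‖cutoff (x i)‖ₑ ≤ 1 := by
    rw [← ofReal_norm, Real.norm_eq_abs]
    exact ENNReal.ofReal_le_one.2 (abs_cutoff_le _)
  calc ‖coordCorrector i φ x‖ₑ ≤ _ := enorm_sub_le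
    _ ≤ _ := add_le_add h1 ((enorm_mul _ _).le.trans (mul_le_mul' h3 h2))
    _ = _ := by rw [one_mul, ENNReal.ofReal_ofNat, two_mul]

theorem exists_l2norm_coordAverage_le (d : ℕ) : ∃ M : ℝ, 0 ≤ M ∧ ∀ (φ : (Fin d → ℝ) → ℝ) (i : Fin d),
    IsTest φ → l2norm (coordAverage i φ) ≤ M * l2norm φ := by
  obtain ⟨M, hM0, hM⟩ := exists_abs_deriv_cutoff_le
  refine ⟨M, hM0, fun φ i h => l2norm_le_of_slice h i hM0 fun x hx => ?_⟩
  rw [coordAverage, enorm_mul]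
  refine mul_le_mul' ?_ (enorm_coordPrimitive_le h i x 1)
  rw [← ofReal_norm, Real.norm_eq_abs]
  exact ENNReal.ofReal_le_ofReal (hM _ ⟨hx.1 i, hx.2 i⟩)

/-! ### The Poincaré inequality -/

/-- Averaging over the coordinates in `s`, one after the other, changes the pairing with `v` by at
most a multiple of the norms of the first weak derivatives of `v`, and turns a test function into
a fixed product of bump functions times a function that does not depend on these coordinates. -/
theorem exists_average (s : Finset (Fin d)) : ∃ C : ℝ, 0 ≤ C ∧ ∀ φ : (Fin d → ℝ) → ℝ, IsTest φ →
    ∃ φ' b : (Fin d → ℝ) → ℝ, IsTest φ' ∧ (∀ x, φ' x = (∏ j ∈ s, deriv cutoff (x j)) * b x) ∧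
      (∀ j ∈ s, ∀ x t, b (Function.update x j t) = b x) ∧ l2norm φ' ≤ C * l2norm φ ∧
      ∀ (v : (Fin d → ℝ) → ℝ) (g : Fin d → (Fin d → ℝ) → ℝ), MemLp v 2 (cubeMeasure d) →
        (∀ i, MemLp (g i) 2 (cubeMeasure d)) → (∀ i, IsWeakDeriv (Pi.single i 1) v (g i)) →
        |∫ x, v x * φ x ∂(cubeMeasure d) - ∫ x, v x * φ' x ∂(cubeMeasure d)| ≤
          C * (∑ i, l2norm (g i)) * l2norm φ := by
  induction s using Finset.induction_on with
  | empty =>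
    refine ⟨1, zero_le_one, fun φ hφ => ⟨φ, φ, hφ, by simp, by simp, by simp, fun v g _ _ _ => ?_⟩⟩
    rw [sub_self, abs_zero, one_mul]
    exact mul_nonneg (Finset.sum_nonneg fun i _ => l2norm_nonneg _) (l2norm_nonneg _)
  | insert i s hi ih =>
    obtain ⟨C, hC0, hC⟩ := ih
    obtain ⟨M, hM0, hM⟩ := exists_l2norm_coordAverage_le d
    refine ⟨M * C + 2 * C + C, by positivity, fun φ hφ => ?_⟩
    obtain ⟨φ', b, hφ', hprod, hb, hn, hv⟩ := hC φ hφ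
    have hnn := l2norm_nonneg φ
    refine ⟨coordAverage i φ', fun x => ∫ t in Set.Iic (1 : ℝ), b (Function.update x i t),
      isTest_coordAverage hφ' i, ?_, ?_, ?_, ?_⟩
    · intro x
      have e : ∀ t, φ' (Function.update x i t) =
          (∏ j ∈ s, deriv cutoff (x j)) * b (Function.update x i t) := by
        intro t
        rw [hprod]
        congr 1
        refine Finset.prod_congr rfl fun j hj => ?_
        rw [Function.update_of_ne (by rintro rfl; exact hi hj)]
      rw [coordAverage, coordPrimitive_update, Finset.prod_insert hi, mul_assoc]
      simp only [e]
      rw [integral_const_mul]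
    · intro j hj x t
      by_cases hji : j = i
      · subst hji; simp
      · have hjs := (Finset.mem_insert.1 hj).resolve_left hji
        simp only [Function.update_comm hji, hb j hjs]
    · calc l2norm (coordAverage i φ') ≤ M * (C * l2norm φ) :=
            (hM φ' i hφ').trans (mul_le_mul_of_nonneg_left hn hM0)
        _ ≤ _ := by
            have : 0 ≤ (2 * C + C) * l2norm φ := by positivity
            linarith
    · intro v g hvm hgm hg
      have h1 := hv v g hvm hgm hg
      have hT := isTest_coordCorrector hφ' i
      have hA := isTest_coordAverage hφ' i
      -- `φ' - coordAverage i φ'` is `∂_i` of the corrector; the derivative is moved onto `v`.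
      have h2 : ∫ x, v x * φ' x ∂(cubeMeasure d) - ∫ x, v x * coordAverage i φ' x ∂(cubeMeasure d) =
          - ∫ x, g i x * coordCorrector i φ' x ∂(cubeMeasure d) := by
        rw [← isWeakDeriv_single_iff.1 (hg i) _ hT, partialDeriv_coordCorrector hφ' i,
          ← integral_sub (integrable_mul hvm (hφ'.memLp 2)) (integrable_mul hvm (hA.memLp 2))]
        simp only [mul_sub]
      have h3 : |∫ x, g i x * coordCorrector i φ' x ∂(cubeMeasure d)| ≤
          (∑ i, l2norm (g i)) * (2 * (C * l2norm φ)) := by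
        refine (abs_integral_mul_le (hgm i) (hT.memLp 2)).trans ?_
        refine mul_le_mul (Finset.single_le_sum (f := fun i => l2norm (g i))
          (fun i _ => l2norm_nonneg _) (Finset.mem_univ i)) ?_ (l2norm_nonneg _)
          (Finset.sum_nonneg fun i _ => l2norm_nonneg _)
        exact (l2norm_coordCorrector_le hφ' i).trans (by linarith)
      have aux : ∀ {a b c w X Y : ℝ}, |a - b| ≤ X → b - c = -w → |w| ≤ Y → |a - c| ≤ X + Y := by
        intro a b c w X Y hX hw hY
        have := abs_sub_le a b c
        rw [hw, abs_neg] at this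
        linarith
      refine (aux h1 h2 h3).trans ?_
      have hS : 0 ≤ ∑ i, l2norm (g i) := Finset.sum_nonneg fun i _ => l2norm_nonneg _
      generalize ∑ i, l2norm (g i) = S at hS
      generalize l2norm φ = N at hnn
      have : 0 ≤ M * C * S * N := by positivity
      linarith

theorem eq_of_forall_update {b : (Fin d → ℝ) → ℝ}
    (h : ∀ j x t, b (Function.update x j t) = b x) (x y : Fin d → ℝ) : b x = b y := by
  have key : ∀ s : Finset (Fin d), b (s.piecewise y x) = b x := by
    intro s
    induction s using Finset.induction_on with
    | empty => simp
    | insert j s _ ih => rw [Finset.piecewise_insert, h, ih]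
  simpa using (key Finset.univ).symm

/-- The Poincaré inequality on the cube for weakly differentiable functions. -/
theorem poincare (d : ℕ) : ∃ C : ℝ, 0 ≤ C ∧
    ∀ (v : (Fin d → ℝ) → ℝ) (g : Fin d → (Fin d → ℝ) → ℝ), MemLp v 2 (cubeMeasure d) →
      (∀ i, MemLp (g i) 2 (cubeMeasure d)) → (∀ i, IsWeakDeriv (Pi.single i 1) v (g i)) →
      ∃ m : ℝ, l2norm (fun x => v x - m) ≤ C * ∑ i, l2norm (g i) := by
  obtain ⟨C, hC0, hC⟩ := exists_average (Finset.univ : Finset (Fin d))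
  set Θ : (Fin d → ℝ) → ℝ := fun x => ∏ j, deriv cutoff (x j) with hΘ
  -- Averaging over all coordinates maps `φ` to a multiple of `Θ`; testing against the constant
  -- function `1` shows that its integral is that of `φ`.
  have key : ∀ φ : (Fin d → ℝ) → ℝ, IsTest φ → ∃ c : ℝ, IsTest (fun x => c * Θ x) ∧
      ∫ x, φ x ∂(cubeMeasure d) = c * ∫ x, Θ x ∂(cubeMeasure d) ∧
      ∀ (v : (Fin d → ℝ) → ℝ) (g : Fin d → (Fin d → ℝ) → ℝ), MemLp v 2 (cubeMeasure d) →
        (∀ i, MemLp (g i) 2 (cubeMeasure d)) → (∀ i, IsWeakDeriv (Pi.single i 1) v (g i)) →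
        |∫ x, v x * φ x ∂(cubeMeasure d) - c * ∫ x, v x * Θ x ∂(cubeMeasure d)| ≤
          C * (∑ i, l2norm (g i)) * l2norm φ := by
    intro φ hφ
    obtain ⟨φ', b, hφ', hprod, hb, -, hv⟩ := hC φ hφ
    have hconst : φ' = fun x => b 0 * Θ x := by
      ext x
      rw [hprod x, eq_of_forall_update (fun j => hb j (Finset.mem_univ j)) x 0, mul_comm]
    have hv' : ∀ v : (Fin d → ℝ) → ℝ, ∫ x, v x * φ' x ∂(cubeMeasure d) =
        b 0 * ∫ x, v x * Θ x ∂(cubeMeasure d) := by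
      intro v
      rw [hconst, ← integral_const_mul]
      refine integral_congr_ae (ae_of_all _ fun x => ?_)
      ring
    refine ⟨b 0, hconst ▸ hφ', ?_, fun v g h1 h2 h3 => hv' v ▸ hv v g h1 h2 h3⟩
    have h1 := hv (fun _ => 1) (fun _ _ => 0) (memLp_const 1) (fun _ => memLp_const 0)
      (fun i => by
        have h := isWeakDeriv_partialDeriv (d := d) (contDiff_const (c := (1 : ℝ))) i
        have e : partialDeriv i (fun _ : Fin d → ℝ => (1 : ℝ)) = fun _ => 0 := by
          ext x; simp [partialDeriv]
        rwa [e] at h)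
    have h0 : l2norm (fun _ : Fin d → ℝ => (0 : ℝ)) = 0 := by simp [l2norm]
    rw [hv'] at h1
    simp only [h0, one_mul, Finset.sum_const_zero, mul_zero, zero_mul] at h1
    exact sub_eq_zero.1 (abs_nonpos_iff.1 h1)
  -- Otherwise every test function would have integral zero.
  have hΘ0 : ∫ x, Θ x ∂(cubeMeasure d) ≠ 0 := by
    intro h0
    have := ae_eq_zero_of_integral_isTest (d := d) (memLp_const (1 : ℝ)) (fun φ hφ => by
      obtain ⟨c, -, hc, -⟩ := key φ hφ
      simpa [h0] using hc)
    have hfalse : ∀ᵐ _ : Fin d → ℝ ∂(cubeMeasure d), False := by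
      filter_upwards [this] with x hx
      simp at hx
    rw [ae_iff] at hfalse
    simp at hfalse
  refine ⟨C, hC0, fun v g hv hg hvg => ?_⟩
  set m : ℝ := (∫ x, v x * Θ x ∂(cubeMeasure d)) / ∫ x, Θ x ∂(cubeMeasure d) with hm
  refine ⟨m, l2norm_le_of_forall_isTest (hv.sub (memLp_const m))
    (mul_nonneg hC0 (Finset.sum_nonneg fun i _ => l2norm_nonneg _)) fun φ hφ => ?_⟩
  obtain ⟨c, -, hc, hbound⟩ := key φ hφ
  have e : ∫ x, (v x - m) * φ x ∂(cubeMeasure d) =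
      ∫ x, v x * φ x ∂(cubeMeasure d) - c * ∫ x, v x * Θ x ∂(cubeMeasure d) := by
    simp only [sub_mul]
    rw [integral_sub (integrable_mul hv (hφ.memLp 2))
      (integrable_mul (memLp_const m) (hφ.memLp 2)), integral_const_mul, hc, hm]
    field_simp
  exact e ▸ hbound v g hv hg hvg

/-! ### Polynomials of bounded degree -/

/-- The polynomials of total degree less than `k`; for `k = 0` only the zero polynomial. -/
noncomputable def polyLT (d k : ℕ) : Submodule ℝ (MvPolynomial (Fin d) ℝ) :=
  MvPolynomial.restrictSupport ℝ {s | s.degree < k}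

theorem mem_polyLT {k : ℕ} {p : MvPolynomial (Fin d) ℝ} :
    p ∈ polyLT d k ↔ ∀ s ∈ p.support, s.degree < k := Iff.rfl

theorem mem_polyLT_succ_iff {k : ℕ} {p : MvPolynomial (Fin d) ℝ} :
    p ∈ polyLT d (k + 1) ↔ p.totalDegree ≤ k := by
  rw [mem_polyLT, MvPolynomial.totalDegree, Finset.sup_le_iff]
  exact forall₂_congr fun s _ => Nat.lt_succ_iff

theorem monomial_mem_polyLT {k : ℕ} {s : Fin d →₀ ℕ} (a : ℝ) (h : s.degree < k) :
    MvPolynomial.monomial s a ∈ polyLT d k :=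
  (MvPolynomial.monomial_mem_restrictSupport ℝ).2 (Or.inl h)

theorem polyLT_mono {j k : ℕ} (h : j ≤ k) : polyLT d j ≤ polyLT d k :=
  fun _ hp s hs => (hp hs : s.degree < j).trans_le h

theorem eq_zero_of_mem_polyLT_zero {p : MvPolynomial (Fin d) ℝ} (h : p ∈ polyLT d 0) : p = 0 := by
  rw [← MvPolynomial.support_eq_empty, Finset.eq_empty_iff_forall_notMem]
  exact fun s hs => absurd (h hs) (Nat.not_lt_zero _)

/-- If `α_i > s_i` for some `i`, then `D^α x^s = 0`. -/
theorem prod_descFactorial_eq_zero {α s : Fin d → ℕ} {i : Fin d} (h : s i < α i) :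
    ∏ j, ((s j).descFactorial (α j) : ℝ) = 0 :=
  Finset.prod_eq_zero (Finset.mem_univ i) (by simpa using h)

theorem isWeakDeriv_sum_eval {ι : Type*} (t : Finset ι) {α : Fin d → ℕ}
    {p q : ι → MvPolynomial (Fin d) ℝ}
    (h : ∀ a ∈ t, IsWeakDeriv α (fun x => MvPolynomial.eval x (p a))
      (fun x => MvPolynomial.eval x (q a))) :
    IsWeakDeriv α (fun x => MvPolynomial.eval x (∑ a ∈ t, p a))
      (fun x => MvPolynomial.eval x (∑ a ∈ t, q a)) := by
  classical
  induction t using Finset.induction_on with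
  | empty => intro φ; simp
  | insert a t ha ih =>
    rw [Finset.sum_insert ha, Finset.sum_insert ha]
    have := (h a (Finset.mem_insert_self a t)).add (memLp_eval _) (memLp_eval _) (memLp_eval _)
      (memLp_eval _) (ih fun b hb => h b (Finset.mem_insert_of_mem hb))
    simpa using this

theorem exists_isWeakDeriv_eval (p : MvPolynomial (Fin d) ℝ) (α : Fin d → ℕ) :
    ∃ q : MvPolynomial (Fin d) ℝ, IsWeakDeriv α (fun x => MvPolynomial.eval x p)
      (fun x => MvPolynomial.eval x q) ∧ (p ∈ polyLT d (∑ i, α i) → q = 0) := by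
  refine ⟨∑ s ∈ p.support, MvPolynomial.monomial (s - Finsupp.equivFunOnFinite.symm α)
    (p.coeff s * ∏ i, ((s i).descFactorial (α i) : ℝ)), ?_, fun hp => ?_⟩
  · have := isWeakDeriv_sum_eval p.support (fun s _ => isWeakDeriv_monomial α s (p.coeff s))
    rwa [MvPolynomial.support_sum_monomial_coeff] at this
  · refine Finset.sum_eq_zero fun s hs => ?_
    have hlt : s.degree < ∑ i, α i := hp hs
    rw [Finsupp.degree_eq_sum] at hlt
    obtain ⟨i, -, hi⟩ := Finset.exists_lt_of_sum_lt hlt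
    rw [prod_descFactorial_eq_zero hi, mul_zero, map_zero]

/-- There is a polynomial of degree `k` with prescribed derivatives of order `k`. -/
theorem exists_eval_deriv_eq (k : ℕ) (m : (Fin d → ℕ) → ℝ) :
    ∃ p ∈ polyLT d (k + 1), ∀ α : Fin d → ℕ, ∑ i, α i = k →
      IsWeakDeriv α (fun x => MvPolynomial.eval x p) (fun _ => m α) := by
  refine ⟨∑ β ∈ Finset.piAntidiag Finset.univ k, MvPolynomial.monomial
    (Finsupp.equivFunOnFinite.symm β) (m β / ∏ i, ((β i).factorial : ℝ)), ?_, fun α hα => ?_⟩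
  · refine Submodule.sum_mem _ fun β hβ => monomial_mem_polyLT _ ?_
    rw [Finsupp.degree_eq_sum]
    have := (Finset.mem_piAntidiag.1 hβ).1
    simp [this]
  · have h := isWeakDeriv_sum_eval (Finset.piAntidiag Finset.univ k) (fun β _ =>
      isWeakDeriv_monomial α (Finsupp.equivFunOnFinite.symm β)
        (m β / ∏ i, ((β i).factorial : ℝ)))
    have hmem : α ∈ Finset.piAntidiag (Finset.univ : Finset (Fin d)) k :=
      Finset.mem_piAntidiag.2 ⟨hα, fun i _ => Finset.mem_univ i⟩
    have hE : ∑ β ∈ Finset.piAntidiag Finset.univ k, MvPolynomial.monomial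
        (Finsupp.equivFunOnFinite.symm β - Finsupp.equivFunOnFinite.symm α)
        ((m β / ∏ i, ((β i).factorial : ℝ)) *
          ∏ i, (((Finsupp.equivFunOnFinite.symm β) i).descFactorial (α i) : ℝ)) =
        MvPolynomial.C (m α) := by
      rw [Finset.sum_eq_single_of_mem α hmem]
      · have hne : ∏ i, ((α i).factorial : ℝ) ≠ 0 :=
          Finset.prod_ne_zero_iff.2 fun i _ => by positivity
        simp only [Finsupp.equivFunOnFinite_symm_apply_apply, Nat.descFactorial_self]
        rw [tsub_self, MvPolynomial.monomial_zero', div_mul_cancel₀ _ hne]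
      · intro β hβ hne
        have hsum : ∑ i, β i = ∑ i, α i := by rw [hα]; exact (Finset.mem_piAntidiag.1 hβ).1
        obtain ⟨i, hi⟩ : ∃ i, β i < α i := by
          by_contra! hc
          refine hne (funext fun i => ?_)
          exact (((Finset.sum_eq_sum_iff_of_le fun i _ => hc i).1 hsum.symm) i
            (Finset.mem_univ i)).symm
        rw [prod_descFactorial_eq_zero (i := i) (by simpa using hi), mul_zero, map_zero]
    rw [hE] at h
    simpa only [MvPolynomial.eval_C] using h

/-! ### The Bramble–Hilbert lemma -/

/-- The Bramble–Hilbert lemma on the unit cube. To pass from order `k` to order `k + 1`, subtract a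
polynomial of degree `k` so that the Poincaré inequality bounds all derivatives of order `k`. -/
theorem brambleHilbert (d k : ℕ) : ∃ C : ℝ, 0 ≤ C ∧
    ∀ (u : (Fin d → ℝ) → ℝ) (g : (Fin d → ℕ) → (Fin d → ℝ) → ℝ), MemLp u 2 (cubeMeasure d) →
      (∀ α, ∑ i, α i ≤ k → MemLp (g α) 2 (cubeMeasure d) ∧ IsWeakDeriv α u (g α)) →
      ∃ p ∈ polyLT d k, l2norm (fun x => u x - MvPolynomial.eval x p) ≤
        C * ∑ α ∈ Finset.piAntidiag Finset.univ k, l2norm (g α) := by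
  induction k with
  | zero =>
    refine ⟨1, zero_le_one, fun u g hu hg => ⟨0, Submodule.zero_mem _, ?_⟩⟩
    have h0 := hg 0 (by simp)
    rw [Finset.piAntidiag_zero, Finset.sum_singleton, one_mul,
      ← l2norm_congr ((isWeakDeriv_zero u).ae_eq hu h0.1 h0.2)]
    simp
  | succ k ih =>
    obtain ⟨C, hC0, hC⟩ := ih
    obtain ⟨P, hP0, hP⟩ := poincare d
    refine ⟨C * ((Finset.piAntidiag (Finset.univ : Finset (Fin d)) k).card * (P * d)),
      by positivity, fun u g hu hg => ?_⟩
    set N := ∑ α ∈ Finset.piAntidiag Finset.univ (k + 1), l2norm (g α) with hN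
    have hm : ∀ α : Fin d → ℕ, ∃ m : ℝ, ∑ i, α i = k → l2norm (fun x => g α x - m) ≤ P * (d * N) := by
      intro α
      by_cases hα : ∑ i, α i = k
      · have hα' : ∀ i, ∑ j, (α + Pi.single i 1 : Fin d → ℕ) j = k + 1 := fun i => by
          rw [sum_add_single, hα]
        have h1 := hg α (by omega)
        have h2 := fun i => hg (α + Pi.single i 1) (hα' i).le
        obtain ⟨m, hm⟩ := hP (g α) (fun i => g (α + Pi.single i 1)) h1.1 (fun i => (h2 i).1)
          (fun i => h1.2.single_iff.2 (h2 i).2)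
        refine ⟨m, fun _ => hm.trans (mul_le_mul_of_nonneg_left ?_ hP0)⟩
        have h3 : ∀ i ∈ Finset.univ, l2norm (g (α + Pi.single i 1)) ≤ N := fun i _ =>
          Finset.single_le_sum (f := fun β => l2norm (g β)) (fun β _ => l2norm_nonneg _)
            (Finset.mem_piAntidiag.2 ⟨hα' i, fun j _ => Finset.mem_univ j⟩)
        simpa using Finset.sum_le_card_nsmul _ _ _ h3
      · exact ⟨0, fun h => absurd h hα⟩
    choose m hm using hm
    obtain ⟨p, hp, hpm⟩ := exists_eval_deriv_eq k m
    have hq : ∀ α : Fin d → ℕ, ∃ q : (Fin d → ℝ) → ℝ, MemLp q 2 (cubeMeasure d) ∧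
        IsWeakDeriv α (fun x => MvPolynomial.eval x p) q ∧ (∑ i, α i = k → q = fun _ => m α) := by
      intro α
      by_cases hα : ∑ i, α i = k
      · exact ⟨_, memLp_const _, hpm α hα, fun _ => rfl⟩
      · obtain ⟨q, hq, -⟩ := exists_isWeakDeriv_eval p α
        exact ⟨_, memLp_eval q, hq, fun h => absurd h hα⟩
    choose q hqm hqd hqk using hq
    obtain ⟨p', hp', hle⟩ := hC (fun x => u x - MvPolynomial.eval x p) (fun α x => g α x - q α x)
      (hu.sub (memLp_eval p)) (fun α hα => by
        have h := hg α (by omega)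
        exact ⟨h.1.sub (hqm α), h.2.sub hu (memLp_eval p) h.1 (hqm α) (hqd α)⟩)
    refine ⟨p + p', Submodule.add_mem _ hp (polyLT_mono k.le_succ hp'), ?_⟩
    have e : (fun x => u x - MvPolynomial.eval x (p + p')) =
        fun x => u x - MvPolynomial.eval x p - MvPolynomial.eval x p' := by
      ext x; rw [map_add]; ring
    rw [e, mul_assoc]
    refine hle.trans (mul_le_mul_of_nonneg_left ?_ hC0)
    have h4 : ∀ α ∈ Finset.piAntidiag (Finset.univ : Finset (Fin d)) k,
        l2norm (fun x => g α x - q α x) ≤ P * (d * N) := by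
      intro α hα
      have hα := (Finset.mem_piAntidiag.1 hα).1
      rw [hqk α hα]
      exact hm α hα
    refine (Finset.sum_le_card_nsmul _ _ _ h4).trans_eq ?_
    rw [nsmul_eq_mul]
    ring

/-! ### Sobolev functions -/

theorem MemSobolev.weakDeriv_spec {k : ℕ} {u : (Fin d → ℝ) → ℝ} (hu : MemSobolev k u)
    {α : Fin d → ℕ} (hα : ∑ i, α i ≤ k) :
    MemLp (weakDeriv α u) 2 (cubeMeasure d) ∧ IsWeakDeriv α u (weakDeriv α u) := by
  have h := hu.2 α hα
  rw [weakDeriv, dif_pos h]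
  exact h.choose_spec

theorem memSobolev_eval (k : ℕ) (p : MvPolynomial (Fin d) ℝ) :
    MemSobolev k (fun x => MvPolynomial.eval x p) := by
  refine ⟨memLp_eval p, fun α _ => ?_⟩
  obtain ⟨q, hq, -⟩ := exists_isWeakDeriv_eval p α
  exact ⟨_, memLp_eval q, hq⟩

theorem sobolevSeminorm_eval {k : ℕ} {p : MvPolynomial (Fin d) ℝ} (hp : p ∈ polyLT d k) :
    sobolevSeminorm k (fun x => MvPolynomial.eval x p) = 0 := by
  rw [sobolevSeminorm, Finset.sum_eq_zero, Real.sqrt_zero]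
  intro α hα
  have hα : ∑ i, α i = k := (Finset.mem_piAntidiag.1 hα).1
  obtain ⟨q, hq, hq0⟩ := exists_isWeakDeriv_eval p α
  have hs := (memSobolev_eval k p).weakDeriv_spec hα.le
  have hae := hs.2.ae_eq hs.1 (memLp_eval q) hq
  rw [eLpNorm_congr_ae hae, hq0 (hα ▸ hp)]
  simp

/-! ### The cells of the uniform mesh -/

theorem cellMap_eq {n : ℕ} (i : Fin d → Fin n) (x : Fin d → ℝ) :
    cellMap n i x = (fun j => ((i j : ℕ) : ℝ) / n) + (1 / n : ℝ) • x := rfl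

theorem cast_pos_of_one_le {n : ℕ} (hn : 1 ≤ n) : (0 : ℝ) < n := by exact_mod_cast hn

theorem contDiff_cellMap {n : ℕ} (i : Fin d → Fin n) : ContDiff ℝ ∞ (cellMap n i) :=
  (contDiff_const (c := fun j => ((i j : ℕ) : ℝ) / n)).add (contDiff_id.const_smul (1 / n : ℝ))

/-- The half-open unit cube, whose images under the cell maps are disjoint. -/
def halfOpenCube (d : ℕ) : Set (Fin d → ℝ) := Set.univ.pi fun _ => Set.Ico (0 : ℝ) 1

theorem mem_halfOpenCube {x : Fin d → ℝ} : x ∈ halfOpenCube d ↔ ∀ j, 0 ≤ x j ∧ x j < 1 := by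
  simp [halfOpenCube]

theorem measurableSet_halfOpenCube : MeasurableSet (halfOpenCube d) :=
  MeasurableSet.univ_pi fun _ => measurableSet_Ico

theorem cubeMeasure_eq_halfOpenCube : cubeMeasure d = volume.restrict (halfOpenCube d) := by
  rw [cubeMeasure, unitCube_eq_pi]
  exact Measure.restrict_congr_set Measure.pi_Ico_ae_eq_pi_Icc.symm

theorem floor_cellMap {n : ℕ} (hn : 1 ≤ n) (i : Fin d → Fin n) {x : Fin d → ℝ}
    (hx : x ∈ halfOpenCube d) (j : Fin d) : ⌊(n : ℝ) * cellMap n i x j⌋₊ = i j := by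
  have hn' := cast_pos_of_one_le hn
  have hx := mem_halfOpenCube.1 hx j
  have e : (n : ℝ) * cellMap n i x j = x j + (i j : ℕ) := by
    rw [cellMap]; field_simp; ring
  rw [e, Nat.floor_add_natCast hx.1, Nat.floor_eq_zero.2 hx.2, zero_add]

theorem cellMap_inj {n : ℕ} (hn : 1 ≤ n) {i i' : Fin d → Fin n} {x x' : Fin d → ℝ}
    (hx : x ∈ halfOpenCube d) (hx' : x' ∈ halfOpenCube d) (h : cellMap n i x = cellMap n i' x') :
    i = i' ∧ x = x' := by
  have hi : i = i' := by
    ext j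
    rw [← floor_cellMap hn i hx, ← floor_cellMap hn i' hx', h]
  refine ⟨hi, ?_⟩
  subst hi
  have hn' := cast_pos_of_one_le hn
  ext j
  have := congrFun h j
  simp only [cellMap] at this
  field_simp at this
  linarith

theorem iUnion_image_cellMap {n : ℕ} (hn : 1 ≤ n) :
    ⋃ i : Fin d → Fin n, cellMap n i '' halfOpenCube d = halfOpenCube d := by
  have hn' := cast_pos_of_one_le hn
  apply Set.Subset.antisymm
  · refine Set.iUnion_subset fun i => ?_
    rintro _ ⟨x, hx, rfl⟩
    rw [mem_halfOpenCube] at hx ⊢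
    intro j
    have h1 : ((i j : ℕ) : ℝ) + 1 ≤ n := by exact_mod_cast (i j).2
    have e : cellMap n i x j = ((i j : ℕ) + x j) / n := by rw [cellMap]; ring
    rw [e, div_lt_one hn']
    exact ⟨div_nonneg (add_nonneg (Nat.cast_nonneg _) (hx j).1) hn'.le, by linarith [(hx j).2]⟩
  · intro y hy
    rw [mem_halfOpenCube] at hy
    have hpos : ∀ j, 0 ≤ (n : ℝ) * y j := fun j => mul_nonneg hn'.le (hy j).1
    have hlt : ∀ j, ⌊(n : ℝ) * y j⌋₊ < n := fun j => by
      rw [Nat.floor_lt (hpos j)]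
      nlinarith [(hy j).2]
    refine Set.mem_iUnion.2 ⟨fun j => ⟨⌊(n : ℝ) * y j⌋₊, hlt j⟩,
      fun j => (n : ℝ) * y j - ⌊(n : ℝ) * y j⌋₊, mem_halfOpenCube.2 fun j => ?_, ?_⟩
    · have h1 := Nat.floor_le (hpos j)
      have h2 := Nat.lt_floor_add_one ((n : ℝ) * y j)
      constructor <;> linarith
    · ext j
      simp only [cellMap]
      field_simp
      ring

/-- An integral over the cube is the sum of the rescaled integrals over the cells. -/
theorem lintegral_eq_sum_cells {n : ℕ} (hn : 1 ≤ n) (f : (Fin d → ℝ) → ℝ≥0∞) :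
    ∫⁻ x, f x ∂(cubeMeasure d) = ∑ i : Fin d → Fin n,
      ENNReal.ofReal ((1 / n : ℝ) ^ d) * ∫⁻ x, f (cellMap n i x) ∂(cubeMeasure d) := by
  have hn' := cast_pos_of_one_le hn
  have hinj : ∀ i : Fin d → Fin n, Set.InjOn (cellMap n i) (halfOpenCube d) :=
    fun i x hx x' hx' h => (cellMap_inj hn hx hx' h).2
  have hderiv : ∀ (i : Fin d → Fin n), ∀ x ∈ halfOpenCube d, HasFDerivWithinAt (cellMap n i)
      ((1 / n : ℝ) • ContinuousLinearMap.id ℝ (Fin d → ℝ)) (halfOpenCube d) x :=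
    fun i x _ => (((hasFDerivAt_id x).const_smul (1 / n : ℝ)).const_add _).hasFDerivWithinAt
  rw [cubeMeasure_eq_halfOpenCube]
  conv_lhs => rw [← iUnion_image_cellMap hn]
  rw [lintegral_iUnion
    (fun i => measurable_image_of_fderivWithin measurableSet_halfOpenCube (hderiv i) (hinj i)),
    tsum_fintype]
  · refine Finset.sum_congr rfl fun i _ => ?_
    rw [lintegral_image_eq_lintegral_abs_det_fderiv_mul volume measurableSet_halfOpenCube
      (hderiv i) (hinj i), ← lintegral_const_mul' _ _ ENNReal.ofReal_ne_top]
    have hdet : ((1 / n : ℝ) • ContinuousLinearMap.id ℝ (Fin d → ℝ)).det = (1 / n : ℝ) ^ d := by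
      rw [ContinuousLinearMap.det]
      simp [LinearMap.det_smul]
    rw [hdet, abs_of_pos (by positivity)]
  · intro i i' hne
    rw [Function.onFun, Set.disjoint_left]
    rintro _ ⟨x, hx, rfl⟩ ⟨x', hx', h⟩
    exact hne (cellMap_inj hn hx' hx h).1.symm

theorem eLpNorm_sq_eq_sum_cells {n : ℕ} (hn : 1 ≤ n) (f : (Fin d → ℝ) → ℝ) :
    eLpNorm f 2 (cubeMeasure d) ^ 2 = ∑ i : Fin d → Fin n, ENNReal.ofReal ((1 / n : ℝ) ^ d) *
      eLpNorm (fun x => f (cellMap n i x)) 2 (cubeMeasure d) ^ 2 := by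
  simp only [eLpNorm_two_sq]
  exact lintegral_eq_sum_cells hn _

theorem l2norm_sq_eq_sum_cells {n : ℕ} (hn : 1 ≤ n) {f : (Fin d → ℝ) → ℝ}
    (hf : ∀ i : Fin d → Fin n, eLpNorm (fun x => f (cellMap n i x)) 2 (cubeMeasure d) ≠ ⊤) :
    l2norm f ^ 2 = ∑ i : Fin d → Fin n, (1 / n : ℝ) ^ d * l2norm (fun x => f (cellMap n i x)) ^ 2 := by
  rw [l2norm, ← ENNReal.toReal_pow, eLpNorm_sq_eq_sum_cells hn, ENNReal.toReal_sum]
  · refine Finset.sum_congr rfl fun i _ => ?_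
    rw [ENNReal.toReal_mul, ENNReal.toReal_ofReal (by positivity), ENNReal.toReal_pow, l2norm]
  · intro i _
    have := hf i
    finiteness

/-- Functions given on the cells can be glued; as the closed cells overlap, they are matched only
on the half-open cells. -/
theorem exists_glue {n : ℕ} (hn : 1 ≤ n) (w : (Fin d → Fin n) → (Fin d → ℝ) → ℝ) :
    ∃ v : (Fin d → ℝ) → ℝ, ∀ i, (fun x => v (cellMap n i x)) =ᵐ[cubeMeasure d] w i := by
  classical
  have h : ∀ y : Fin d → ℝ, ∃ c : ℝ, ∀ i, ∀ x ∈ halfOpenCube d, cellMap n i x = y → c = w i x := by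
    intro y
    by_cases hy : ∃ i, ∃ x ∈ halfOpenCube d, cellMap n i x = y
    · obtain ⟨i, x, hx, hxy⟩ := hy
      refine ⟨w i x, fun i' x' hx' hxy' => ?_⟩
      obtain ⟨rfl, rfl⟩ := cellMap_inj hn hx hx' (hxy.trans hxy'.symm)
      rfl
    · exact ⟨0, fun i x hx hxy => absurd ⟨i, x, hx, hxy⟩ hy⟩
  choose v hv using h
  refine ⟨v, fun i => ?_⟩
  rw [cubeMeasure_eq_halfOpenCube]
  exact (ae_restrict_iff' measurableSet_halfOpenCube).2 (ae_of_all _ fun x hx => hv _ i x hx rfl)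

/-! ### Pulling back Sobolev functions to the reference cube -/

theorem integral_comp_cellMap {n : ℕ} (i : Fin d → Fin n) (f : (Fin d → ℝ) → ℝ) :
    ∫ x, f (cellMap n i x) = |((1 / n : ℝ) ^ d)⁻¹| * ∫ x, f x := by
  simp only [cellMap_eq]
  rw [Measure.integral_comp_smul volume (fun y => f ((fun j => ((i j : ℕ) : ℝ) / n) + y)) (1 / n : ℝ),
    integral_add_left_eq_self]
  simp

theorem multiDeriv_const_mul {f : (Fin d → ℝ) → ℝ} (hf : ContDiff ℝ ∞ f) (c : ℝ) (α : Fin d → ℕ) :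
    multiDeriv α (fun x => c * f x) = fun x => c * multiDeriv α f x := by
  induction α using multiIndex_induction generalizing f with
  | zero => simp only [multiDeriv_zero]
  | step α i ih =>
    have e : partialDeriv i (fun x => c * f x) = fun x => c * partialDeriv i f x := by
      ext x
      simp only [partialDeriv]
      rw [fderiv_const_mul (hf.differentiable (by simp) x)]
      rfl
    rw [multiDeriv_add_single hf, multiDeriv_add_single (contDiff_const.mul hf), e,
      ih (contDiff_partialDeriv hf i)]

theorem multiDeriv_comp_affine {f : (Fin d → ℝ) → ℝ} (hf : ContDiff ℝ ∞ f) (c : ℝ) (b : Fin d → ℝ)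
    (α : Fin d → ℕ) :
    multiDeriv α (fun x => f (b + c • x)) = fun x => c ^ (∑ i, α i) * multiDeriv α f (b + c • x) := by
  have hcomp : ∀ {f : (Fin d → ℝ) → ℝ}, ContDiff ℝ ∞ f → ContDiff ℝ ∞ (fun x => f (b + c • x)) :=
    fun hf => hf.comp (contDiff_const.add (contDiff_id.const_smul c))
  induction α using multiIndex_induction generalizing f with
  | zero => simp [multiDeriv_zero]
  | step α i ih =>
    have e : partialDeriv i (fun x => f (b + c • x)) = fun x => c * partialDeriv i f (b + c • x) := by
      ext x
      have h1 : HasFDerivAt (fun x : Fin d → ℝ => b + c • x)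
          (c • ContinuousLinearMap.id ℝ (Fin d → ℝ)) x :=
        ((hasFDerivAt_id x).const_smul c).const_add b
      have h2 := ((hf.differentiable (by simp) (b + c • x)).hasFDerivAt.comp x h1).fderiv
      simp only [partialDeriv]
      rw [show (fun x => f (b + c • x)) = f ∘ fun x => b + c • x from rfl, h2]
      simp
    have hf' := contDiff_partialDeriv hf i
    rw [multiDeriv_add_single hf, multiDeriv_add_single (hcomp hf), e,
      multiDeriv_const_mul (hcomp hf'), ih hf', sum_add_single]
    ext x
    ring

/-- The inverse of `cellMap n i` is `y ↦ n y - i`. -/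
theorem affine_cellMap {n : ℕ} (hn : 1 ≤ n) (i : Fin d → Fin n) (x : Fin d → ℝ) :
    (fun j => -((i j : ℕ) : ℝ)) + (n : ℝ) • cellMap n i x = x := by
  have hn' := cast_pos_of_one_le hn
  ext j
  simp only [Pi.add_apply, Pi.smul_apply, smul_eq_mul, cellMap]
  field_simp
  ring

theorem IsTest.comp_affine {n : ℕ} (hn : 1 ≤ n) (i : Fin d → Fin n) {φ : (Fin d → ℝ) → ℝ}
    (h : IsTest φ) : IsTest (fun y => φ ((fun j => -((i j : ℕ) : ℝ)) + (n : ℝ) • y)) := by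
  have hn' := cast_pos_of_one_le hn
  obtain ⟨δ, hδ0, hδ⟩ := h.2
  refine ⟨h.1.comp (contDiff_const.add (contDiff_id.const_smul _)), δ / n, by positivity,
    fun y hy j => ?_⟩
  have := hδ _ hy j
  simp only [Pi.add_apply, Pi.smul_apply, smul_eq_mul] at this
  have h1 : ((i j : ℕ) : ℝ) + 1 ≤ n := by exact_mod_cast (i j).2
  have h2 : (0 : ℝ) ≤ (i j : ℕ) := Nat.cast_nonneg _
  have h3 : 1 - δ / n = (n - δ) / n := by field_simp
  rw [div_le_iff₀ hn', h3, le_div_iff₀ hn']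
  constructor <;> linarith

/-- Derivatives of order `|α|` pick up the factor `h ^ |α|` on the reference cube. -/
theorem IsWeakDeriv.comp_cellMap {n : ℕ} (hn : 1 ≤ n) (i : Fin d → Fin n) {α : Fin d → ℕ}
    {u g : (Fin d → ℝ) → ℝ} (h : IsWeakDeriv α u g) :
    IsWeakDeriv α (fun x => u (cellMap n i x))
      (fun x => (1 / n : ℝ) ^ (∑ i, α i) * g (cellMap n i x)) := by
  rw [isWeakDeriv_iff] at h ⊢
  intro φ hφ
  have hn' := cast_pos_of_one_le hn
  set ψ : (Fin d → ℝ) → ℝ := fun y => φ ((fun j => -((i j : ℕ) : ℝ)) + (n : ℝ) • y) with hψ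
  have hψt : IsTest ψ := hφ.comp_affine hn i
  have h1 : ∀ x, u (cellMap n i x) * CubeApprox.multiDeriv α φ x = (1 / n : ℝ) ^ (∑ i, α i) *
      (u (cellMap n i x) * CubeApprox.multiDeriv α ψ (cellMap n i x)) := by
    intro x
    rw [hψ, multiDeriv_comp_affine hφ.1]
    simp only [affine_cellMap hn]
    rw [mul_left_comm _ ((n : ℝ) ^ _), ← mul_assoc (_ ^ _) (_ ^ _), ← mul_pow,
      one_div_mul_cancel hn'.ne', one_pow, one_mul]
  have h2 : ∀ x, (1 / n : ℝ) ^ (∑ i, α i) * g (cellMap n i x) * φ x = (1 / n : ℝ) ^ (∑ i, α i) *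
      (g (cellMap n i x) * ψ (cellMap n i x)) := by
    intro x
    simp only [hψ, affine_cellMap hn]
    ring
  rw [integral_cube_eq (fun x hx => by rw [(hφ.multiDeriv α).eq_zero hx, mul_zero]),
    integral_cube_eq (fun x hx => by rw [hφ.eq_zero hx, mul_zero])]
  have h3 := h ψ hψt
  rw [integral_cube_eq (fun x hx => by rw [(hψt.multiDeriv α).eq_zero hx, mul_zero]),
    integral_cube_eq (fun x hx => by rw [hψt.eq_zero hx, mul_zero])] at h3
  simp only [h1, h2]
  rw [integral_const_mul, integral_const_mul,
    integral_comp_cellMap i (fun y => u y * CubeApprox.multiDeriv α ψ y),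
    integral_comp_cellMap i (fun y => g y * ψ y), h3]
  ring

/-- The image of Lebesgue measure on the cube under a cell map is `n ^ d` times Lebesgue measure on the
cell. -/
theorem map_cellMap_le {n : ℕ} (hn : 1 ≤ n) (i : Fin d → Fin n) :
    (cubeMeasure d).map (cellMap n i) ≤ ENNReal.ofReal ((n : ℝ) ^ d) • cubeMeasure d := by
  have hn' := cast_pos_of_one_le hn
  refine Measure.le_iff.2 fun A hA => ?_
  have hm : Measurable (cellMap n i) := (contDiff_cellMap i).continuous.measurable
  rw [Measure.map_apply hm hA, Measure.smul_apply, smul_eq_mul, ← lintegral_indicator_one hA,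
    lintegral_eq_sum_cells hn, ← lintegral_indicator_one (hm hA)]
  refine le_trans ?_ (mul_le_mul_right (Finset.single_le_sum (fun i _ => zero_le)
    (Finset.mem_univ i)) _)
  rw [← mul_assoc, ← ENNReal.ofReal_mul (by positivity), ← mul_pow, mul_one_div_cancel hn'.ne',
    one_pow, ENNReal.ofReal_one, one_mul]
  rfl

theorem memLp_comp_cellMap {n : ℕ} (hn : 1 ≤ n) (i : Fin d → Fin n) {f : (Fin d → ℝ) → ℝ}
    (hf : MemLp f 2 (cubeMeasure d)) : MemLp (fun x => f (cellMap n i x)) 2 (cubeMeasure d) :=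
  ((hf.smul_measure ENNReal.ofReal_ne_top).mono_measure (map_cellMap_le hn i)).comp_of_map
    (contDiff_cellMap i).continuous.measurable.aemeasurable

/-! ### The error estimate for spaces containing the polynomials -/

/-- On each cell the Bramble–Hilbert lemma, pulled back to the reference cube, provides a polynomial;
these are glued to an element of the mesh space, and the squared errors add up over the cells. -/
theorem mesh_error_le (S : Submodule ℝ (L2Cube d)) (r : ℕ)
    (hS : ∀ p ∈ polyLT d (r + 1), BelongsTo S (fun x => MvPolynomial.eval x p)) :
    ∃ C : ℝ, ∀ n : ℕ, 1 ≤ n → ∀ u : (Fin d → ℝ) → ℝ, MemSobolev (r + 1) u →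
      bestError S n u ≤ C * (1 / n : ℝ) ^ (r + 1) * sobolevSeminorm (r + 1) u := by
  obtain ⟨C, hC0, hC⟩ := brambleHilbert d (r + 1)
  set I := Finset.piAntidiag (Finset.univ : Finset (Fin d)) (r + 1) with hI
  refine ⟨C * √I.card, fun n hn u hu => ?_⟩
  have hn' := cast_pos_of_one_le hn
  set h : ℝ := 1 / n with hh
  have hh0 : 0 ≤ h := by positivity
  have hspec := fun (α : Fin d → ℕ) (hα : ∑ i, α i ≤ r + 1) => hu.weakDeriv_spec hα
  -- On the reference cube, `D^α (u ∘ cellMap n i) = h ^ |α| * (D^α u) ∘ cellMap n i`.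
  have hcell : ∀ i : Fin d → Fin n, ∃ p ∈ polyLT d (r + 1),
      l2norm (fun x => u (cellMap n i x) - MvPolynomial.eval x p) ≤
        C * ∑ α ∈ I, l2norm (fun x => h ^ (∑ i, α i) * weakDeriv α u (cellMap n i x)) :=
    fun i => hC _ _ (memLp_comp_cellMap hn i hu.1) fun α hα =>
      ⟨(memLp_comp_cellMap hn i (hspec α hα).1).const_mul _, (hspec α hα).2.comp_cellMap hn i⟩
  choose p hp hle using hcell
  obtain ⟨v, hv⟩ := exists_glue hn fun i x => MvPolynomial.eval x (p i)
  have hvS : v ∈ meshSpace S n := fun i => by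
    obtain ⟨w, hw, hae⟩ := hS _ (hp i)
    exact ⟨w, hw, (hv i).trans hae⟩
  have hdiff : ∀ i, (fun x => (u - v) (cellMap n i x)) =ᵐ[cubeMeasure d]
      fun x => u (cellMap n i x) - MvPolynomial.eval x (p i) := fun i => by
    filter_upwards [hv i] with x hx
    rw [Pi.sub_apply, hx]
  have hfin : ∀ i : Fin d → Fin n,
      eLpNorm (fun x => (u - v) (cellMap n i x)) 2 (cubeMeasure d) ≠ ⊤ := fun i => by
    rw [eLpNorm_congr_ae (hdiff i)]
    exact ((memLp_comp_cellMap hn i hu.1).sub (memLp_eval (p i))).eLpNorm_ne_top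
  have hfin' : eLpNorm (u - v) 2 (cubeMeasure d) ≠ ⊤ := by
    have : eLpNorm (u - v) 2 (cubeMeasure d) ^ 2 ≠ ⊤ := by
      rw [eLpNorm_sq_eq_sum_cells hn]
      refine ENNReal.sum_ne_top.2 fun i _ => ?_
      have := hfin i
      finiteness
    intro htop
    simp [htop] at this
  have hbest : bestError S n u ≤ l2norm (u - v) :=
    ENNReal.toReal_mono hfin' (iInf₂_le v hvS)
  refine hbest.trans (le_of_sq_le_sq ?_ ?_)
  · have hterm : ∀ i : Fin d → Fin n, l2norm (fun x => (u - v) (cellMap n i x)) ^ 2 ≤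
        C ^ 2 * I.card * h ^ (2 * (r + 1)) *
          ∑ α ∈ I, l2norm (fun x => weakDeriv α u (cellMap n i x)) ^ 2 := by
      intro i
      have e : ∑ α ∈ I, l2norm (fun x => h ^ (∑ i, α i) * weakDeriv α u (cellMap n i x)) =
          h ^ (r + 1) * ∑ α ∈ I, l2norm (fun x => weakDeriv α u (cellMap n i x)) := by
        rw [Finset.mul_sum]
        refine Finset.sum_congr rfl fun α hα => ?_
        rw [l2norm_const_mul, (Finset.mem_piAntidiag.1 hα).1, abs_of_nonneg (by positivity)]
      have h1 := hle i
      rw [e] at h1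
      rw [l2norm_congr (hdiff i)]
      refine (pow_le_pow_left₀ (l2norm_nonneg _) h1 2).trans ?_
      have h2 := sq_sum_le_card_mul_sum_sq (s := I)
        (f := fun α => l2norm (fun x => weakDeriv α u (cellMap n i x)))
      calc _ = C ^ 2 * h ^ (2 * (r + 1)) *
            (∑ α ∈ I, l2norm (fun x => weakDeriv α u (cellMap n i x))) ^ 2 := by ring
        _ ≤ _ := mul_le_mul_of_nonneg_left h2 (by positivity)
        _ = _ := by ring
    rw [l2norm_sq_eq_sum_cells hn hfin]
    calc _ ≤ ∑ i : Fin d → Fin n, h ^ d * (C ^ 2 * I.card * h ^ (2 * (r + 1)) *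
            ∑ α ∈ I, l2norm (fun x => weakDeriv α u (cellMap n i x)) ^ 2) :=
          Finset.sum_le_sum fun i _ => mul_le_mul_of_nonneg_left (hterm i) (by positivity)
      _ = C ^ 2 * I.card * h ^ (2 * (r + 1)) * ∑ α ∈ I, ∑ i : Fin d → Fin n,
            h ^ d * l2norm (fun x => weakDeriv α u (cellMap n i x)) ^ 2 := by
          rw [Finset.sum_comm, Finset.mul_sum]
          refine Finset.sum_congr rfl fun i _ => ?_
          rw [← Finset.mul_sum]
          ring
      _ = C ^ 2 * I.card * h ^ (2 * (r + 1)) * ∑ α ∈ I, l2norm (weakDeriv α u) ^ 2 := by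
          congr 1
          refine Finset.sum_congr rfl fun α hα => ?_
          have hα := (Finset.mem_piAntidiag.1 hα).1
          rw [l2norm_sq_eq_sum_cells hn fun i =>
            (memLp_comp_cellMap hn i (hspec α hα.le).1).eLpNorm_ne_top]
      _ = _ := by
          rw [mul_pow, mul_pow, mul_pow, Real.sq_sqrt (Nat.cast_nonneg _), sobolevSeminorm,
            Real.sq_sqrt (Finset.sum_nonneg fun _ _ => sq_nonneg _)]
          simp only [l2norm]
          ring
  · exact mul_nonneg (by positivity) (Real.sqrt_nonneg _)

/-! ### Necessity of the polynomials -/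

theorem mul_X_mem_polyLT {k : ℕ} {p : MvPolynomial (Fin d) ℝ} (hp : p ∈ polyLT d k) (i : Fin d) :
    p * MvPolynomial.X i ∈ polyLT d (k + 1) := by
  rw [mem_polyLT] at hp ⊢
  intro s hs
  rw [MvPolynomial.support_mul_X, Finset.mem_map] at hs
  obtain ⟨t, ht, rfl⟩ := hs
  simpa using hp t ht

/-- The affine substitution `x ↦ b + c x` in a polynomial. -/
noncomputable def affineSubst (b : Fin d → ℝ) (c : ℝ) :
    MvPolynomial (Fin d) ℝ →ₐ[ℝ] MvPolynomial (Fin d) ℝ :=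
  MvPolynomial.aeval fun j => MvPolynomial.C (b j) + MvPolynomial.C c * MvPolynomial.X j

theorem eval_affineSubst (b : Fin d → ℝ) (c : ℝ) (p : MvPolynomial (Fin d) ℝ) (x : Fin d → ℝ) :
    MvPolynomial.eval x (affineSubst b c p) = MvPolynomial.eval (fun j => b j + c * x j) p := by
  induction p using MvPolynomial.induction_on with
  | C a => simp [affineSubst]
  | add p q hp hq => simp [hp, hq]
  | mul_X p j hp => rw [map_mul, map_mul, hp, map_mul]; simp [affineSubst]

theorem affineSubst_monomial_sub_mem (b : Fin d → ℝ) (c : ℝ) (k : ℕ) (s : Fin d →₀ ℕ)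
    (hs : s.degree = k) :
    affineSubst b c (MvPolynomial.monomial s 1) - c ^ k • MvPolynomial.monomial s 1 ∈
      polyLT d k := by
  induction k generalizing s with
  | zero =>
    rw [Finsupp.degree_eq_zero_iff] at hs
    subst hs
    simp [affineSubst]
  | succ k ih =>
    obtain ⟨i, hi⟩ : ∃ i, s i ≠ 0 := by
      by_contra! hc
      have : s = 0 := Finsupp.ext hc
      simp [this] at hs
    obtain ⟨t, rfl⟩ : ∃ t, s = t + Finsupp.single i 1 :=
      ⟨s - Finsupp.single i 1, (tsub_add_cancel_of_le
        (Finsupp.single_le_iff.2 (Nat.one_le_iff_ne_zero.2 hi))).symm⟩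
    have ht : t.degree = k := by simpa using hs
    have hmon : MvPolynomial.monomial (t + Finsupp.single i 1) (1 : ℝ) =
        MvPolynomial.monomial t 1 * MvPolynomial.X i := by
      rw [MvPolynomial.X, MvPolynomial.monomial_mul, one_mul]
    have h1 := ih t ht
    have h2 : affineSubst b c (MvPolynomial.monomial t 1) ∈ polyLT d (k + 1) := by
      have := Submodule.add_mem _ (polyLT_mono k.le_succ h1) (Submodule.smul_mem _ (c ^ k)
        (monomial_mem_polyLT (k := k + 1) 1 (ht.trans_lt k.lt_succ_self)))
      simpa using this
    have hX : affineSubst b c (MvPolynomial.X i) =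
        MvPolynomial.C (b i) + MvPolynomial.C c * MvPolynomial.X i := by simp [affineSubst]
    have e : affineSubst b c (MvPolynomial.monomial (t + Finsupp.single i 1) 1) -
        c ^ (k + 1) • MvPolynomial.monomial (t + Finsupp.single i 1) 1 =
        b i • affineSubst b c (MvPolynomial.monomial t 1) +
        c • ((affineSubst b c (MvPolynomial.monomial t 1) -
          c ^ k • MvPolynomial.monomial t 1) * MvPolynomial.X i) := by
      rw [hmon, map_mul, hX]
      simp only [MvPolynomial.smul_eq_C_mul, map_pow]
      ring
    rw [e]
    exact Submodule.add_mem _ (Submodule.smul_mem _ _ h2)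
      (Submodule.smul_mem _ _ (mul_X_mem_polyLT h1 i))

/-- On polynomials of degree at most `k`, the substitution `x ↦ b + c x` is multiplication by `c ^ k`
modulo polynomials of degree less than `k`. -/
theorem affineSubst_sub_mem (b : Fin d → ℝ) (c : ℝ) {k : ℕ} {p : MvPolynomial (Fin d) ℝ}
    (hp : p ∈ polyLT d (k + 1)) : affineSubst b c p - c ^ k • p ∈ polyLT d k := by
  rw [polyLT, MvPolynomial.restrictSupport_eq_span] at hp
  induction hp using Submodule.span_induction with
  | zero => simp
  | add p q _ _ hp hq =>
    rw [map_add, smul_add, add_sub_add_comm]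
    exact Submodule.add_mem _ hp hq
  | smul a p _ hp =>
    rw [map_smul, smul_comm, ← smul_sub]
    exact Submodule.smul_mem _ _ hp
  | mem p hp =>
    obtain ⟨s, hs, rfl⟩ := hp
    have hs : s.degree < k + 1 := hs
    have h1 := affineSubst_monomial_sub_mem b c s.degree s rfl
    rcases (Nat.lt_succ_iff.1 hs).eq_or_lt with h | h
    · rwa [h] at h1
    · have hm := monomial_mem_polyLT (d := d) (1 : ℝ) h
      have h2 := Submodule.add_mem _ (polyLT_mono h.le h1) (Submodule.smul_mem _ (c ^ s.degree) hm)
      rw [sub_add_cancel] at h2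
      exact Submodule.sub_mem _ h2 (Submodule.smul_mem _ _ hm)

/-- If `S` contains the polynomials of degree less than `k`, then on each cell a polynomial of
degree `k` looks, modulo `S`, like `h ^ k` times itself, so its mesh error is `h ^ k` times its
distance from `S`. -/
theorem le_bestError (S : Submodule ℝ (L2Cube d)) {k : ℕ}
    (hS : ∀ q ∈ polyLT d k, BelongsTo S (fun x => MvPolynomial.eval x q))
    {p : MvPolynomial (Fin d) ℝ} (hp : p ∈ polyLT d (k + 1)) {n : ℕ} (hn : 1 ≤ n) :
    (1 / n : ℝ) ^ k * Metric.infDist ((memLp_eval p).toLp _) (S : Set (L2Cube d)) ≤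
      bestError S n (fun x => MvPolynomial.eval x p) := by
  have hn' := cast_pos_of_one_le hn
  set P : L2Cube d := (memLp_eval p).toLp _ with hP
  set h : ℝ := 1 / n with hh
  have hh0 : 0 < h := by positivity
  set δ := Metric.infDist P (S : Set (L2Cube d)) with hδ
  have hδ0 : 0 ≤ δ := Metric.infDist_nonneg
  rw [bestError, ← ENNReal.ofReal_le_iff_le_toReal (iInf_meshSpace_lt_top S n (memLp_eval p)).ne]
  refine le_iInf₂ fun v hv => ?_
  rw [← ENNReal.pow_le_pow_left_iff two_ne_zero, eLpNorm_sq_eq_sum_cells hn]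
  have hcell : ∀ i : Fin d → Fin n, ENNReal.ofReal (h ^ k * δ) ≤
      eLpNorm (fun x => ((fun x => MvPolynomial.eval x p) - v) (cellMap n i x)) 2
        (cubeMeasure d) := by
    intro i
    obtain ⟨w, hw, hvw⟩ := hv i
    obtain ⟨q, hq, hqe⟩ := hS _ (affineSubst_sub_mem (fun j => ((i j : ℕ) : ℝ) / n) h hp)
    set w' : L2Cube d := (h ^ k)⁻¹ • (w - q) with hw'
    have hw'S : w' ∈ S := S.smul_mem _ (S.sub_mem hw hq)
    have hae : (fun x => ((fun x => MvPolynomial.eval x p) - v) (cellMap n i x)) =ᵐ[cubeMeasure d]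
        ((h ^ k • (P - w') : L2Cube d) : (Fin d → ℝ) → ℝ) := by
      have e : h ^ k • (P - w') = h ^ k • P - (w - q) := by
        rw [smul_sub, hw', smul_inv_smul₀ (by positivity)]
      rw [e]
      filter_upwards [hvw, hqe, Lp.coeFn_sub (h ^ k • P) (w - q), Lp.coeFn_sub w q,
        Lp.coeFn_smul (h ^ k) P, (memLp_eval p).coeFn_toLp] with x h1 h2 h3 h4 h5 h6
      rw [h3, Pi.sub_apply, Pi.sub_apply, h4, h5, Pi.sub_apply, Pi.smul_apply, h6, ← h1, ← h2,
        map_sub, eval_affineSubst, MvPolynomial.smul_eval, smul_eq_mul]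
      have hc : cellMap n i x = fun j => ((i j : ℕ) : ℝ) / n + h * x j := rfl
      rw [hc]
      ring
    rw [eLpNorm_congr_ae hae, ← Lp.enorm_def, ← ofReal_norm, norm_smul,
      Real.norm_of_nonneg (by positivity)]
    refine ENNReal.ofReal_le_ofReal (mul_le_mul_of_nonneg_left ?_ (by positivity))
    rw [← dist_eq_norm]
    exact Metric.infDist_le_dist_of_mem hw'S
  -- There are `n ^ d` cells, each of volume `h ^ d`.
  calc ENNReal.ofReal (h ^ k * δ) ^ 2
      = ∑ i : Fin d → Fin n, ENNReal.ofReal (h ^ d) * ENNReal.ofReal (h ^ k * δ) ^ 2 := by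
        rw [Finset.sum_const, nsmul_eq_mul, ← mul_assoc]
        have : ((Finset.univ : Finset (Fin d → Fin n)).card : ℝ≥0∞) * ENNReal.ofReal (h ^ d) = 1 := by
          rw [← ENNReal.ofReal_natCast, ← ENNReal.ofReal_mul (Nat.cast_nonneg _)]
          simp [hh, hn'.ne']
        rw [this, one_mul]
    _ ≤ _ := Finset.sum_le_sum fun i _ => by gcongr; exact hcell i

/-- If the mesh error of all polynomials of degree at most `r` is `o(h ^ r)`, then `S` contains them,
by induction on the degree; finite dimension of `S` enters through its closedness. -/
theorem belongsTo_of_isLittleO (S : Submodule ℝ (L2Cube d)) [FiniteDimensional ℝ S] (r : ℕ)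
    (H : ∀ p : MvPolynomial (Fin d) ℝ, p.totalDegree ≤ r →
      (fun n : ℕ => bestError S n (fun x => MvPolynomial.eval x p))
        =o[atTop] (fun n : ℕ => (1 / n : ℝ) ^ r))
    (k : ℕ) (hk : k ≤ r + 1) :
    ∀ p ∈ polyLT d k, BelongsTo S (fun x => MvPolynomial.eval x p) := by
  induction k with
  | zero =>
    intro p hp
    rw [eq_zero_of_mem_polyLT_zero hp]
    exact ⟨0, S.zero_mem, by
      simp only [map_zero]
      exact (Lp.coeFn_zero ℝ 2 (cubeMeasure d)).symm⟩
  | succ k ih =>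
    intro p hp
    set P : L2Cube d := (memLp_eval p).toLp _ with hP
    set δ := Metric.infDist P (S : Set (L2Cube d)) with hδ
    have hδ0 : 0 ≤ δ := Metric.infDist_nonneg
    have hle := fun n (hn : 1 ≤ n) => le_bestError S (ih (by omega)) hp (n := n) hn
    have ho := H p (mem_polyLT_succ_iff.1 (polyLT_mono hk hp))
    -- The lower bound `h ^ k * δ` is `o(h ^ r)` with `k ≤ r`, which forces `δ = 0`.
    have hδε : ∀ ε > 0, δ ≤ ε := by
      intro ε hε
      obtain ⟨n, hb, hn⟩ := ((isLittleO_iff.1 ho hε).and (eventually_ge_atTop 1)).exists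
      have hn' := cast_pos_of_one_le hn
      have hh0 : (0 : ℝ) < 1 / n := by positivity
      have hh1 : (1 / n : ℝ) ≤ 1 := by
        rw [div_le_one hn']; exact_mod_cast hn
      have hb0 : 0 ≤ bestError S n (fun x => MvPolynomial.eval x p) := ENNReal.toReal_nonneg
      rw [Real.norm_of_nonneg hb0, Real.norm_of_nonneg (by positivity)] at hb
      have h1 : (1 / n : ℝ) ^ r ≤ (1 / n : ℝ) ^ k :=
        pow_le_pow_of_le_one hh0.le hh1 (by omega)
      have h2 : (1 / n : ℝ) ^ k * δ ≤ (1 / n : ℝ) ^ k * ε :=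
        (hle n hn).trans (hb.trans (by rw [mul_comm]; gcongr))
      exact le_of_mul_le_mul_left h2 (by positivity)
    have hzero : δ = 0 := le_antisymm (le_of_forall_pos_le_add fun ε hε => by
      simpa using hδε ε hε) hδ0
    have hmem : P ∈ S := by
      have hcl : IsClosed (S : Set (L2Cube d)) := S.closed_of_finiteDimensional
      exact (hcl.mem_iff_infDist_zero ⟨0, S.zero_mem⟩).2 hzero
    exact ⟨P, hmem, (memLp_eval p).coeFn_toLp.symm⟩

end CubeApprox

theorem mainTheorem3 (d : ℕ) (hd : 1 ≤ d) (S : Submodule ℝ (CubeApprox.L2Cube d))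
    [FiniteDimensional ℝ S] (r : ℕ) :
    List.TFAE [
      ∃ C : ℝ, ∀ n : ℕ, 1 ≤ n → ∀ u : (Fin d → ℝ) → ℝ, CubeApprox.MemSobolev (r + 1) u →
        CubeApprox.bestError S n u ≤
          C * (1 / n : ℝ) ^ (r + 1) * CubeApprox.sobolevSeminorm (r + 1) u,
      ∀ p : MvPolynomial (Fin d) ℝ, p.totalDegree ≤ r →
        (fun n : ℕ => CubeApprox.bestError S n (fun x => MvPolynomial.eval x p))
          =o[atTop] (fun n : ℕ => (1 / n : ℝ) ^ r),
      ∀ p : MvPolynomial (Fin d) ℝ, p.totalDegree ≤ r →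
        CubeApprox.BelongsTo S (fun x => MvPolynomial.eval x p)] := by
  tfae_have 1 → 2 := by
    rintro ⟨C, hC⟩ p hp
    have hev : (fun n : ℕ => CubeApprox.bestError S n (fun x => MvPolynomial.eval x p)) =ᶠ[atTop]
        fun _ => (0 : ℝ) := by
      filter_upwards [eventually_ge_atTop 1] with n hn
      have h := hC n hn _ (CubeApprox.memSobolev_eval (r + 1) p)
      rw [CubeApprox.sobolevSeminorm_eval (CubeApprox.mem_polyLT_succ_iff.2 hp), mul_zero] at h
      exact le_antisymm h ENNReal.toReal_nonneg
    exact (isLittleO_zero _ _).congr' hev.symm EventuallyEq.rfl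
  tfae_have 2 → 3 := fun H p hp =>
    CubeApprox.belongsTo_of_isLittleO S r H (r + 1) le_rfl p (CubeApprox.mem_polyLT_succ_iff.2 hp)
  tfae_have 3 → 1 := fun H =>
    CubeApprox.mesh_error_le S r fun p hp => H p (CubeApprox.mem_polyLT_succ_iff.1 hp)
  tfae_finish
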